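/- Let $1\le k\le d$ and $N\ge 1$ be integers, let $\mathcal X=\{x_1,\dots,x_N\}\subset\mathbb R^d$ consist of $N$ distinct points, let $p\ge 1$ be an even integer and $\lambda>0$. **Notation.** Let $S_{d,k}=\{E\in\mathbb R^{d\times k}:E^\top E=I_k\}$, and for $E\in S_{d,k}$ let $\mathcal X_E=(E^\top x_1,\dots,E^\top x_N)$ and let $c_p(\mathcal X_E)\in\mathbb R^{N^2}$ be the cost vector with entries $\|E^\top x_i-E^\top x_j\|^p$, indexed by pairs $(i,j)$. Let $A\in\mathbb R^{2N\times N^2}$ be the matrix of the marginal constraints, $A\pi=\big((\sum_j\pi_{ij})_i,(\sum_i\pi_{ij})_j\big)$, and let $A_\star\in\mathbb R^{(2N-1)\times N^2}$ be $A$ with its last row deleted; for $h\in\mathbb R^N$ let $h_\star\in\mathbb R^{N-1}$ be $h$ with its last entry deleted. For probability vectors $r,s\in\mathbb R^N_{\ge0}$ let $\pi_{p,\lambda}(r,s;\mathcal X_E)$ be the unique minimizer of $\langle c_p(\mathcal X_E),\pi\rangle+\lambda\sum_{i,j}(\pi_{ij}\log\pi_{ij}-\pi_{ij}+1)$ (with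 $0\log0=0$) over all $\pi\in\mathbb R^{N^2}_{\ge0}$ with $A\pi=(r,s)^\top$. Put $$W_{p,\lambda}(r,s;\mathcal X_E)=\langle c_p(\mathcal X_E),\pi_{p,\lambda}(r,s;\mathcal X_E)\rangle^{1/p},\qquad \mathrm{PW}_{p,\lambda}(r,s)=\max_{E\in S_{d,k}}W_{p,\lambda}(r,s;\mathcal X_E),$$ and $\Psi_p^*(r,s_\star)=\{E\in S_{d,k}:W_{p,\lambda}(r,s;\mathcal X_E)=\mathrm{PW}_{p,\lambda}(r,s)\}$. For $E\in\Psi^*_p(r,s_\star)$ let $D=D_E\in\mathbb R^{N^2\times N^2}$ be the diagonal matrix whose diagonal is $\pi_{p,\lambda}(r,s;\mathcal X_E)$, and let $$\gamma=\gamma_E=\tfrac1p\,\langle c_p(\mathcal X_E),\pi_{p,\lambda}(r,s;\mathcal X_E)\rangle^{\frac1p-1}\,c_p(\mathcal X_E)\in\mathbb R^{N^2},$$ which is the gradient of $\pi\mapsto\langle c_p(\mathcal X_E),\pi\rangle^{1/p}$ at the regularized plan (for $N=1$, where $c_p=0$, $\gamma=0$). For a probability vector $r$ let $\Sigma(r)\in\mathbb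 R^{N\times N}$ be the matrix with diagonal entries $r_i(1-r_i)$ and off-diagonal entries $-r_ir_j$. **Theorem.** Let $r,s\in\mathbb R^N_{>0}$ be probability vectors with strictly positive entries, identified with the distributions on $\mathcal X$ that give mass $r_i$, respectively $s_i$, to $x_i$. Let $X_1,X_2,\dots\sim r$ and $Y_1,Y_2,\dots\sim s$ be i.i.d. samples, independent of each other, and let $\hat r_{n,i}=\#\{l\le n:X_l=x_i\}/n$ and $\hat s_{m,i}=\#\{l\le m:Y_l=x_i\}/m$ be the empirical distributions. Let $G\sim N(0,\Sigma(r))$ and $H\sim N(0,\Sigma(s))$ be independent Gaussian random vectors. Then, as $n\wedge m\to\infty$ and $m/(n+m)\to\delta\in(0,1)$, $$\sqrt{\frac{nm}{n+m}}\,\{\mathrm{PW}_{p,\lambda}(\hat r_n,\hat s_m)-\mathrm{PW}_{p,\lambda}(r,s)\}\;\xrightarrow{d}\;\max_{E\in\Psi_p^*(r,s_\star)}\big\langle\gamma_E^\top D_EA_\star^\top(A_\star D_EA_\star^\top)^{-1},(\sqrt\delta\,G,\sqrt{1-\delta}\,H_\star)\big\rangle,$$ the maximum on the right being attained. -/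

import Mathlib

open MeasureTheory ProbabilityTheory Filter Topology Matrix

noncomputable section

namespace PRW

/-- The (relatively open) simplex of strictly positive probability vectors of length `N`. -/
def posSimplex (N : ℕ) : Set (Fin N → ℝ) := {r | (∀ i, 0 < r i) ∧ ∑ i, r i = 1}

/-- The cost vector `c_p(𝒳)`, indexed by pairs: `c_p(𝒳)_{(i,j)} = ‖x_i - x_j‖ ^ p`. -/
def costVec {N k : ℕ} (p : ℕ) (y : Fin N → EuclideanSpace ℝ (Fin k)) : Fin N × Fin N → ℝ :=
  fun ij => ‖y ij.1 - y ij.2‖ ^ p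

/-- The marginal matrix `A` (`2N` rows, `N²` columns): the first `N` rows compute the first marginal,
the last `N` rows the second marginal of `π`. -/
def marginalMatrix (N : ℕ) : Matrix (Fin N ⊕ Fin N) (Fin N × Fin N) ℝ :=
  Matrix.of fun row ij =>
    Sum.elim (fun i => if ij.1 = i then (1 : ℝ) else 0) (fun j => if ij.2 = j then (1 : ℝ) else 0) row

/-- Deletion of the last entry of a vector. -/
def dropLast {N : ℕ} (h : Fin (N + 1) → ℝ) : Fin N → ℝ := fun j => h j.castSucc

/-- The matrix `A_⋆`: the marginal matrix with its last row deleted. -/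
def marginalMatrixStar (N : ℕ) : Matrix (Fin (N + 1) ⊕ Fin N) (Fin (N + 1) × Fin (N + 1)) ℝ :=
  (marginalMatrix (N + 1)).submatrix (Sum.map id Fin.castSucc) id

/-- Nonnegative couplings of `r` and `s`. (The entropy is `+∞` at vectors with a negative entry, so
that the regularized problem is a minimization over this set.) -/
def couplings {N : ℕ} (r s : Fin N → ℝ) : Set (Fin N × Fin N → ℝ) :=
  {π | (∀ ij, 0 ≤ π ij) ∧ marginalMatrix N *ᵥ π = Sum.elim r s}

/-- The negative Boltzmann-Shannon entropy on nonnegative vectors (`0 * log 0 = 0` in Lean). -/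
def negEntropy {N : ℕ} (π : Fin N × Fin N → ℝ) : ℝ :=
  ∑ ij, (π ij * Real.log (π ij) - π ij + 1)

/-- The objective `⟨c, π⟩ + lam * φ(π)` of entropic optimal transport. -/
def entropicObjective {N : ℕ} (lam : ℝ) (c π : Fin N × Fin N → ℝ) : ℝ :=
  c ⬝ᵥ π + lam * negEntropy π

/-- `π` is an optimal solution of the entropic optimal transport problem. -/
def IsRegPlan {N : ℕ} (lam : ℝ) (c : Fin N × Fin N → ℝ) (r s : Fin N → ℝ)
    (π : Fin N × Fin N → ℝ) : Prop :=
  π ∈ couplings r s ∧ IsMinOn (entropicObjective lam c) (couplings r s) π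

/-- The regularized optimal transport plan: the optimal solution, which exists and is unique for
probability vectors `r`, `s` and `lam > 0` (see `existsUnique_isRegPlan`). -/
def regPlan {N : ℕ} (lam : ℝ) (c : Fin N × Fin N → ℝ) (r s : Fin N → ℝ) : Fin N × Fin N → ℝ :=
  Classical.epsilon (IsRegPlan lam c r s)

/-- The regularized optimal transport distance `W_{p,lam}(r, s; 𝒳)` for the support points `y`. -/
def regW {N k : ℕ} (p : ℕ) (lam : ℝ) (y : Fin N → EuclideanSpace ℝ (Fin k))
    (r s : Fin N → ℝ) : ℝ :=
  (costVec p y ⬝ᵥ regPlan lam (costVec p y) r s) ^ ((1 : ℝ) / (p : ℝ))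

/-- The set `S_{d,k}` of `d × k` matrices with orthonormal columns. -/
def stiefel (d k : ℕ) : Set (Matrix (Fin d) (Fin k) ℝ) := {E | Eᵀ * E = 1}

/-- The projected points `E^⊤ x_1, …, E^⊤ x_N`. -/
def projPts {N d k : ℕ} (x : Fin N → EuclideanSpace ℝ (Fin d)) (E : Matrix (Fin d) (Fin k) ℝ) :
    Fin N → EuclideanSpace ℝ (Fin k) :=
  fun i => WithLp.toLp 2 (Eᵀ *ᵥ (x i).ofLp)

/-- The regularized projection robust Wasserstein distance: the maximum over `E ∈ S_{d,k}` of
`W_{p,lam}(r, s; 𝒳_E)` (it is attained, see `isGreatest_regPW`). -/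
def regPW {N d : ℕ} (k p : ℕ) (lam : ℝ) (x : Fin N → EuclideanSpace ℝ (Fin d))
    (r s : Fin N → ℝ) : ℝ :=
  sSup ((fun E => regW p lam (projPts x E) r s) '' stiefel d k)

/-- The set of optimal projection directions. -/
def optDirs {N d : ℕ} (k p : ℕ) (lam : ℝ) (x : Fin N → EuclideanSpace ℝ (Fin d))
    (r s : Fin N → ℝ) : Set (Matrix (Fin d) (Fin k) ℝ) :=
  {E ∈ stiefel d k | regW p lam (projPts x E) r s = regPW k p lam x r s}

/-- The vector `γ = (1/p) ⟨c, π⟩^{1/p - 1} c`. -/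
def gammaVec {N : ℕ} (p : ℕ) (c π : Fin N × Fin N → ℝ) : Fin N × Fin N → ℝ :=
  ((1 : ℝ) / (p : ℝ) * (c ⬝ᵥ π) ^ ((1 : ℝ) / (p : ℝ) - 1)) • c

/-- The row vector `γ^⊤ D A_⋆^⊤ (A_⋆ D A_⋆^⊤)⁻¹`, where `D` is the diagonal matrix of `π`. -/
def sensitivityVec {N : ℕ} (p : ℕ) (c π : Fin (N + 1) × Fin (N + 1) → ℝ) :
    Fin (N + 1) ⊕ Fin N → ℝ :=
  gammaVec p c π ᵥ* (Matrix.diagonal π * (marginalMatrixStar N)ᵀ *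
    (marginalMatrixStar N * Matrix.diagonal π * (marginalMatrixStar N)ᵀ)⁻¹)

/-- `⟨γ^⊤ D A_⋆^⊤ (A_⋆ D A_⋆^⊤)⁻¹, (h₁, (h₂)_⋆)⟩` for the projection direction `E`, with the vector
`γ` and the matrix `D` taken at the regularized plan between the projections. -/
def dirDeriv {N d k : ℕ} (p : ℕ) (lam : ℝ) (x : Fin (N + 1) → EuclideanSpace ℝ (Fin d))
    (r s : Fin (N + 1) → ℝ) (h₁ h₂ : Fin (N + 1) → ℝ) (E : Matrix (Fin d) (Fin k) ℝ) : ℝ :=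
  let c := costVec p (projPts x E)
  sensitivityVec p c (regPlan lam c r s) ⬝ᵥ Sum.elim h₁ (dropLast h₂)

/-- The multinomial covariance matrix `Σ(r)`: entries `r_i (1 - r_i)` on the diagonal and
`- r_i r_j` off the diagonal. -/
def covMat {N : ℕ} (r : Fin N → ℝ) : Matrix (Fin N) (Fin N) ℝ :=
  Matrix.of fun i j => if i = j then r i * (1 - r i) else -(r i * r j)

/-- The probability measure on `ℝ^d` that gives mass `r i` to the point `x i`. -/
def discreteLaw {N d : ℕ} (x : Fin N → EuclideanSpace ℝ (Fin d)) (r : Fin N → ℝ) :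
    Measure (EuclideanSpace ℝ (Fin d)) :=
  ∑ i, ENNReal.ofReal (r i) • Measure.dirac (x i)

open Classical in
/-- The empirical distribution of the first `n` sample points, as a vector of frequencies. -/
def empirical {N d : ℕ} {Ω : Type*} (x : Fin N → EuclideanSpace ℝ (Fin d))
    (X : ℕ → Ω → EuclideanSpace ℝ (Fin d)) (n : ℕ) (ω : Ω) : Fin N → ℝ :=
  fun i => (((Finset.range n).filter fun l => X l ω = x i).card : ℝ) / (n : ℝ)

/-! Well-posedness of the definitions. -/

theorem marginalMatrix_mulVec_inl {N : ℕ} (π : Fin N × Fin N → ℝ) (i : Fin N) :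
    (marginalMatrix N *ᵥ π) (Sum.inl i) = ∑ j, π (i, j) := by
  simp only [marginalMatrix, Matrix.mulVec, dotProduct, Fintype.sum_prod_type_right]
  simp

theorem marginalMatrix_mulVec_inr {N : ℕ} (π : Fin N × Fin N → ℝ) (j : Fin N) :
    (marginalMatrix N *ᵥ π) (Sum.inr j) = ∑ i, π (i, j) := by
  simp [marginalMatrix, Matrix.mulVec, dotProduct, Fintype.sum_prod_type]

theorem continuous_entropicObjective {N : ℕ} (lam : ℝ) :
    Continuous fun q : (Fin N × Fin N → ℝ) × (Fin N × Fin N → ℝ) =>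
      entropicObjective lam q.1 q.2 := by
  unfold entropicObjective negEntropy dotProduct
  have h := Real.continuous_mul_log
  have h2 : ∀ ij : Fin N × Fin N, Continuous
      fun q : (Fin N × Fin N → ℝ) × (Fin N × Fin N → ℝ) => q.2 ij * Real.log (q.2 ij) :=
    fun ij => h.comp (by fun_prop : Continuous
      fun q : (Fin N × Fin N → ℝ) × (Fin N × Fin N → ℝ) => q.2 ij)
  fun_prop

theorem isCompact_couplings {N : ℕ} (r s : Fin N → ℝ) : IsCompact (couplings r s) := by
  have hcl : IsClosed (couplings r s) := by
    have h1 : IsClosed {π : Fin N × Fin N → ℝ | ∀ ij, 0 ≤ π ij} := by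
      simp only [Set.ofPred_forall]
      exact isClosed_iInter fun ij => isClosed_le continuous_const (continuous_apply ij)
    have h2 : IsClosed {π : Fin N × Fin N → ℝ | marginalMatrix N *ᵥ π = Sum.elim r s} :=
      isClosed_eq (by fun_prop) continuous_const
    exact h1.inter h2
  refine (isCompact_univ_pi fun ij : Fin N × Fin N => isCompact_Icc (a := 0) (b := r ij.1)).of_isClosed_subset
    hcl ?_
  rintro π ⟨h0, h1⟩ ⟨i, j⟩ -
  refine ⟨h0 _, ?_⟩
  have h := congrFun h1 (Sum.inl i)
  rw [marginalMatrix_mulVec_inl] at h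
  simp only [Sum.elim_inl] at h
  rw [← h]
  exact Finset.single_le_sum (f := fun j => π (i, j)) (fun j _ => h0 _) (Finset.mem_univ j)

theorem couplings_nonempty {N : ℕ} {r s : Fin N → ℝ}
    (hr : r ∈ stdSimplex ℝ (Fin N)) (hs : s ∈ stdSimplex ℝ (Fin N)) :
    (couplings r s).Nonempty := by
  refine ⟨fun ij => r ij.1 * s ij.2, fun ij => mul_nonneg (hr.1 _) (hs.1 _), ?_⟩
  ext (i | j)
  · rw [marginalMatrix_mulVec_inl]
    simp [← Finset.mul_sum, hs.2]
  · rw [marginalMatrix_mulVec_inr]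
    simp [← Finset.sum_mul, hr.2]

theorem convex_couplings {N : ℕ} (r s : Fin N → ℝ) : Convex ℝ (couplings r s) := by
  rintro π ⟨h0, h1⟩ π' ⟨h0', h1'⟩ a b ha hb hab
  refine ⟨fun ij => ?_, ?_⟩
  · have := mul_nonneg ha (h0 ij)
    have := mul_nonneg hb (h0' ij)
    simp only [Pi.add_apply, Pi.smul_apply, smul_eq_mul]
    linarith
  · rw [Matrix.mulVec_add, Matrix.mulVec_smul, Matrix.mulVec_smul, h1, h1', ← add_smul, hab, one_smul]

theorem strictConvexOn_entropicObjective {N : ℕ} {lam : ℝ} (hlam : 0 < lam)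
    (c : Fin N × Fin N → ℝ) (r s : Fin N → ℝ) :
    StrictConvexOn ℝ (couplings r s) (entropicObjective lam c) := by
  refine ⟨convex_couplings r s, ?_⟩
  rintro π ⟨h0, -⟩ π' ⟨h0', -⟩ hne a b ha hb hab
  have key : negEntropy (a • π + b • π') < a * negEntropy π + b * negEntropy π' := by
    unfold negEntropy
    rw [Finset.mul_sum, Finset.mul_sum, ← Finset.sum_add_distrib]
    obtain ⟨ij, hij⟩ := Function.ne_iff.1 hne
    refine Finset.sum_lt_sum (fun q _ => ?_) ⟨ij, Finset.mem_univ _, ?_⟩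
    · have := Real.strictConvexOn_mul_log.convexOn.2 (h0 q) (h0' q) ha.le hb.le hab
      simp only [Pi.add_apply, Pi.smul_apply, smul_eq_mul] at this ⊢
      linear_combination this + (1 : ℝ) * hab.symm
    · have := Real.strictConvexOn_mul_log.2 (h0 ij) (h0' ij) hij ha hb hab
      simp only [Pi.add_apply, Pi.smul_apply, smul_eq_mul] at this ⊢
      linear_combination this + (1 : ℝ) * hab.symm
  have := mul_lt_mul_of_pos_left key hlam
  simp only [entropicObjective, dotProduct_add, dotProduct_smul, smul_eq_mul]
  linear_combination this

/-- Existence and uniqueness of the regularized optimal transport plan. -/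
theorem existsUnique_isRegPlan {N : ℕ} {lam : ℝ} (hlam : 0 < lam) (c : Fin N × Fin N → ℝ)
    {r s : Fin N → ℝ} (hr : r ∈ stdSimplex ℝ (Fin N)) (hs : s ∈ stdSimplex ℝ (Fin N)) :
    ∃! π, IsRegPlan lam c r s π := by
  have hcont : Continuous (entropicObjective lam c) :=
    (continuous_entropicObjective lam).comp (by fun_prop : Continuous fun π => (c, π))
  obtain ⟨π, h1, h2⟩ := (isCompact_couplings r s).exists_isMinOn (couplings_nonempty hr hs)
    hcont.continuousOn
  exact ⟨π, ⟨h1, h2⟩, fun π' h' =>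
    (strictConvexOn_entropicObjective hlam c r s).eq_of_isMinOn h'.2 h2 h'.1 h1⟩

theorem isRegPlan_regPlan {N : ℕ} {lam : ℝ} (hlam : 0 < lam) (c : Fin N × Fin N → ℝ)
    {r s : Fin N → ℝ} (hr : r ∈ stdSimplex ℝ (Fin N)) (hs : s ∈ stdSimplex ℝ (Fin N)) :
    IsRegPlan lam c r s (regPlan lam c r s) :=
  Classical.epsilon_spec (existsUnique_isRegPlan hlam c hr hs).exists

theorem continuous_regPlan {N : ℕ} {lam : ℝ} (hlam : 0 < lam)
    {r s : Fin N → ℝ} (hr : r ∈ stdSimplex ℝ (Fin N)) (hs : s ∈ stdSimplex ℝ (Fin N)) :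
    Continuous fun c => regPlan lam c r s := by
  refine continuous_iff_continuousAt.2 fun c₀ => ?_
  refine (isCompact_couplings r s).tendsto_nhds_of_unique_mapClusterPt
    (Eventually.of_forall fun c => (isRegPlan_regPlan hlam c hr hs).1) fun π hπ hcl => ?_
  obtain ⟨U, hU, hlim⟩ := mapClusterPt_iff_ultrafilter.1 hcl
  refine (existsUnique_isRegPlan hlam c₀ hr hs).unique ⟨hπ, fun π' hπ' => ?_⟩
    (isRegPlan_regPlan hlam c₀ hr hs)
  have hc : Tendsto (fun c : Fin N × Fin N → ℝ => c) U (𝓝 c₀) := hU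
  have h1 := ((continuous_entropicObjective lam).tendsto (c₀, π)).comp (hc.prodMk_nhds hlim)
  have h2 := ((continuous_entropicObjective lam).tendsto (c₀, π')).comp
    (hc.prodMk_nhds (tendsto_const_nhds (x := π')))
  exact le_of_tendsto_of_tendsto h1 h2
    (Eventually.of_forall fun c => (isRegPlan_regPlan hlam c hr hs).2 hπ')

theorem isCompact_stiefel (d k : ℕ) : IsCompact (stiefel d k) := by
  have hcl : IsClosed (stiefel d k) := isClosed_eq (by fun_prop) continuous_const
  refine (isCompact_univ_pi fun _ : Fin d =>
    isCompact_univ_pi fun _ : Fin k => isCompact_Icc (a := (-1 : ℝ)) (b := 1)).of_isClosed_subset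
    hcl ?_
  intro (E : Matrix (Fin d) (Fin k) ℝ) hE i _ j _
  have h := congrFun (congrFun (show Eᵀ * E = 1 from hE) j) j
  rw [Matrix.mul_apply, Matrix.one_apply_eq] at h
  have h2 : E i j * E i j ≤ 1 := by
    rw [← h]
    exact Finset.single_le_sum (f := fun i => Eᵀ j i * E i j) (fun i _ => mul_self_nonneg (E i j))
      (Finset.mem_univ i)
  exact abs_le.1 (abs_le_one_iff_mul_self_le_one.2 h2)

theorem stiefel_nonempty {d k : ℕ} (hkd : k ≤ d) : (stiefel d k).Nonempty := by
  refine ⟨(1 : Matrix (Fin d) (Fin d) ℝ).submatrix id (Fin.castLE hkd), ?_⟩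
  ext i j
  simp only [Matrix.mul_apply, Matrix.transpose_apply, Matrix.submatrix_apply, id, Matrix.one_apply]
  rw [Finset.sum_eq_single (Fin.castLE hkd i)]
  · simp
  · intro b _ hb
    simp [hb]
  · simp

/-- The maximum in the definition of the regularized projection robust Wasserstein distance is
attained. -/
theorem isGreatest_regPW {N d k p : ℕ} (hkd : k ≤ d) {lam : ℝ} (hlam : 0 < lam)
    (x : Fin N → EuclideanSpace ℝ (Fin d)) {r s : Fin N → ℝ}
    (hr : r ∈ stdSimplex ℝ (Fin N)) (hs : s ∈ stdSimplex ℝ (Fin N)) :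
    IsGreatest ((fun E => regW p lam (projPts x E) r s) '' stiefel d k) (regPW k p lam x r s) := by
  have hc : Continuous fun E : Matrix (Fin d) (Fin k) ℝ => costVec p (projPts x E) := by
    unfold costVec projPts
    fun_prop
  have hW : Continuous fun E : Matrix (Fin d) (Fin k) ℝ => regW p lam (projPts x E) r s := by
    unfold regW
    refine Continuous.rpow_const ?_ fun E => Or.inr (by positivity)
    exact hc.dotProduct ((continuous_regPlan hlam hr hs).comp hc)
  exact ((isCompact_stiefel d k).image hW).isGreatest_sSup ((stiefel_nonempty hkd).image _)

/-- `Σ(r)` is positive semidefinite. -/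
theorem posSemidef_covMat {N : ℕ} {r : Fin N → ℝ} (hr : r ∈ stdSimplex ℝ (Fin N)) :
    (covMat r).PosSemidef := by
  have hE : covMat r = Matrix.diagonal r - Matrix.vecMulVec r r := by
    ext i j
    by_cases h : i = j
    · subst h
      simp [covMat, Matrix.vecMulVec_apply]
      ring
    · simp [covMat, Matrix.vecMulVec_apply, h]
  refine Matrix.PosSemidef.of_dotProduct_mulVec_nonneg ?_ fun v => ?_
  · ext i j
    by_cases h : i = j
    · subst h
      simp [covMat]
    · simp [covMat, h, Ne.symm h, mul_comm]
  · have h1 : star v ⬝ᵥ covMat r *ᵥ v = ∑ i, r i * v i ^ 2 - (∑ i, r i * v i) ^ 2 := by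
      rw [hE, Matrix.sub_mulVec, dotProduct_sub]
      congr 1
      · simp [dotProduct, Matrix.mulVec_diagonal]
        exact Finset.sum_congr rfl fun i _ => by ring
      · rw [Matrix.vecMulVec_mulVec]
        simp only [dotProduct, Pi.star_apply, star_trivial, Pi.smul_apply, MulOpposite.smul_eq_mul_unop,
          MulOpposite.unop_op, sq, Finset.sum_mul]
        exact Finset.sum_congr rfl fun i _ => by ring
    rw [h1, sub_nonneg]
    have h2 := Finset.sum_sq_le_sum_mul_sum_of_sq_le_mul Finset.univ (r := fun i => r i * v i)
      (f := r) (g := fun i => r i * v i ^ 2) (fun i _ => hr.1 i)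
      (fun i _ => mul_nonneg (hr.1 i) (sq_nonneg _)) (fun i _ => le_of_eq (by ring))
    rwa [hr.2, one_mul] at h2

end PRW

end

noncomputable section

namespace PRW

/-! Let `b` be the pair of marginals. For a fixed direction `E` the distance is a smooth function of
`b` near positive marginals, and the projection robust distance is the maximum of these functions
over the compact set `stiefel d k`. By Danskin's argument such a maximum has a one-sided directional
derivative, namely the maximum of the individual derivatives over the optimal directions. This
derivative is in general not linear, but it is continuous and positively homogeneous, which is all
the delta method needs once the multinomial central limit theorem is available.

The individual derivative comes from the Gibbs form `π = exp ((A_⋆ᵀ u - c) / lam)` of the optimal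
plan. Differentiating `A_⋆ π = b` in `u` gives `du = lam (A_⋆ D A_⋆ᵀ)⁻¹ db`, hence `dπ = D A_⋆ᵀ (A_⋆
D A_⋆ᵀ)⁻¹ db`; deleting one redundant constraint is what makes the inverted matrix nonsingular.
Danskin's argument needs expansions uniform in `E` near each optimal direction. Since `E` enters
only through the cost vector, this follows from strict differentiability of the plan jointly in cost
and marginals (`exists_hasStrictFDerivAt_regPlan`, `eventually_abs_rpow_sub_le`).

The root `t ^ (1 / p)` may fail to be differentiable at zero. With two or more points the optimal
cost is positive; with one point everything is constant (`cost_pos_of_mem_optDirs`). The analytic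
half is assembled in `exists_directional_expansion_regPW` from `eventually_abs_isGreatest_sub_le`,
and the probabilistic half is `tendstoInDistribution_of_directional_expansion`. -/

/-! ### Reduced constraints and the Gibbs form of the optimal plan. -/

/-- The vector `exp ((A_⋆ᵀ u - c) / lam)` with dual potential `u`. -/
def gibbs {N : ℕ} (lam : ℝ) (c : Fin (N + 1) × Fin (N + 1) → ℝ) (u : Fin (N + 1) ⊕ Fin N → ℝ) :
    Fin (N + 1) × Fin (N + 1) → ℝ :=
  fun ij => Real.exp ((((marginalMatrixStar N)ᵀ *ᵥ u) ij - c ij) / lam)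

theorem gibbs_pos {N : ℕ} (lam : ℝ) (c : Fin (N + 1) × Fin (N + 1) → ℝ)
    (u : Fin (N + 1) ⊕ Fin N → ℝ) (ij : Fin (N + 1) × Fin (N + 1)) : 0 < gibbs lam c u ij :=
  Real.exp_pos _

theorem marginalMatrixStar_mulVec {N : ℕ} (π : Fin (N + 1) × Fin (N + 1) → ℝ) :
    marginalMatrixStar N *ᵥ π =
      Sum.elim (fun i => ∑ j, π (i, j)) (dropLast fun j => ∑ i, π (i, j)) := by
  ext (i | j)
  · exact marginalMatrix_mulVec_inl π i
  · exact marginalMatrix_mulVec_inr π j.castSucc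

theorem marginalMatrixStar_transpose_mulVec_castSucc {N : ℕ} (u : Fin (N + 1) ⊕ Fin N → ℝ)
    (i : Fin (N + 1)) (j : Fin N) :
    ((marginalMatrixStar N)ᵀ *ᵥ u) (i, j.castSucc) = u (Sum.inl i) + u (Sum.inr j) := by
  simp [marginalMatrixStar, marginalMatrix, Matrix.mulVec, dotProduct]

theorem marginalMatrixStar_transpose_mulVec_last {N : ℕ} (u : Fin (N + 1) ⊕ Fin N → ℝ)
    (i : Fin (N + 1)) :
    ((marginalMatrixStar N)ᵀ *ᵥ u) (i, Fin.last N) = u (Sum.inl i) := by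
  have : ∀ j : Fin N, Fin.last N ≠ j.castSucc := fun j => (Fin.castSucc_lt_last j).ne'
  simp [marginalMatrixStar, marginalMatrix, Matrix.mulVec, dotProduct, this]

/-- Deleting the last row fixes the last column potential at zero, so the entries in the last column
read off the row potentials and any row then determines the remaining ones. The full matrix lacks
this property, because constants can be moved between the two blocks. -/
theorem marginalMatrixStar_transpose_injective (N : ℕ) :
    Function.Injective ((marginalMatrixStar N)ᵀ *ᵥ ·) := by
  intro u v huv
  have h := fun ij => congrFun huv ij
  simp only at h
  have h1 : ∀ i, u (Sum.inl i) = v (Sum.inl i) := fun i => by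
    simpa only [marginalMatrixStar_transpose_mulVec_last] using h (i, Fin.last N)
  ext (i | j)
  · exact h1 i
  · have := h (0, j.castSucc)
    simp only [marginalMatrixStar_transpose_mulVec_castSucc, h1] at this
    linarith

/-- The deleted constraint is redundant: with equal total masses, the last column sum is forced by
the others. -/
theorem couplings_iff_star {N : ℕ} {r s : Fin (N + 1) → ℝ} (hrs : ∑ i, r i = ∑ i, s i)
    (π : Fin (N + 1) × Fin (N + 1) → ℝ) :
    marginalMatrix (N + 1) *ᵥ π = Sum.elim r s ↔
      marginalMatrixStar N *ᵥ π = Sum.elim r (dropLast s) := by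
  rw [marginalMatrixStar_mulVec]
  constructor
  · intro h
    have h1 : (fun i => ∑ j, π (i, j)) = r := by
      ext i
      rw [← marginalMatrix_mulVec_inl, h, Sum.elim_inl]
    have h2 : (fun j => ∑ i, π (i, j)) = s := by
      ext i
      rw [← marginalMatrix_mulVec_inr, h, Sum.elim_inr]
    rw [h1, h2]
  · intro h
    have h1 : ∀ i, ∑ j, π (i, j) = r i := fun i => by simpa using congrFun h (Sum.inl i)
    have h2 : ∀ j : Fin N, ∑ i, π (i, j.castSucc) = s j.castSucc := fun j => by
      simpa [dropLast] using congrFun h (Sum.inr j)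
    have h3 : ∑ i, π (i, Fin.last N) = s (Fin.last N) := by
      have e1 : ∑ j, ∑ i, π (i, j) = ∑ i, s i := by
        rw [Finset.sum_comm, ← hrs]
        exact Finset.sum_congr rfl fun i _ => h1 i
      rw [Fin.sum_univ_castSucc, Fin.sum_univ_castSucc (f := s)] at e1
      simp only [h2] at e1
      linarith
    ext (i | j)
    · rw [marginalMatrix_mulVec_inl, h1, Sum.elim_inl]
    · rw [marginalMatrix_mulVec_inr, Sum.elim_inr]
      induction j using Fin.lastCases with
      | last => exact h3
      | cast j => exact h2 j

/-- This is `log z ≤ z - 1` at `z = x / y`, that is, the graph of `y log y - y` lies above its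
tangents. The value `y = 0` is included because competing couplings may have zero entries. -/
theorem mul_log_sub_le {x y : ℝ} (hx : 0 < x) (hy : 0 ≤ y) :
    Real.log x * (y - x) ≤ (y * Real.log y - y) - (x * Real.log x - x) := by
  rcases hy.eq_or_lt with rfl | hy
  · simp
    nlinarith
  · have h := Real.log_le_sub_one_of_pos (div_pos hx hy)
    rw [Real.log_div hx.ne' hy.ne'] at h
    have h2 := mul_le_mul_of_nonneg_left h hy.le
    have h3 : y * (x / y - 1) = x - y := by field_simp
    rw [h3] at h2
    nlinarith

/-- A coupling of Gibbs form solves the entropic optimal transport problem. -/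
theorem isRegPlan_gibbs {N : ℕ} {lam : ℝ} (hlam : 0 < lam)
    {c : Fin (N + 1) × Fin (N + 1) → ℝ} {u : Fin (N + 1) ⊕ Fin N → ℝ} {r s : Fin (N + 1) → ℝ}
    (hrs : ∑ i, r i = ∑ i, s i)
    (h : marginalMatrixStar N *ᵥ gibbs lam c u = Sum.elim r (dropLast s)) :
    IsRegPlan lam c r s (gibbs lam c u) := by
  refine ⟨⟨fun ij => (gibbs_pos lam c u ij).le, (couplings_iff_star hrs _).2 h⟩, fun π hπ => ?_⟩
  -- The linear term of the tangent inequality is `A_⋆ᵀ u`, which cannot distinguish couplings with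
  -- the same marginals; summing the entrywise inequalities therefore proves optimality.
  have h0 : (marginalMatrixStar N)ᵀ *ᵥ u ⬝ᵥ (π - gibbs lam c u) = 0 := by
    rw [Matrix.mulVec_transpose, ← Matrix.dotProduct_mulVec, Matrix.mulVec_sub, h,
      (couplings_iff_star hrs _).1 hπ.2, sub_self, dotProduct_zero]
  have h1 : ∀ ij, ((marginalMatrixStar N)ᵀ *ᵥ u) ij * (π ij - gibbs lam c u ij) ≤
      (c ij * π ij + lam * (π ij * Real.log (π ij) - π ij + 1)) -
      (c ij * gibbs lam c u ij + lam * (gibbs lam c u ij * Real.log (gibbs lam c u ij)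
        - gibbs lam c u ij + 1)) := fun ij => by
    have h2 := mul_le_mul_of_nonneg_left (mul_log_sub_le (gibbs_pos lam c u ij) (hπ.1 ij)) hlam.le
    have h3 : lam * Real.log (gibbs lam c u ij) = ((marginalMatrixStar N)ᵀ *ᵥ u) ij - c ij := by
      rw [gibbs, Real.log_exp]
      field_simp
    rw [← mul_assoc, h3] at h2
    linarith
  have h4 := Finset.sum_le_sum fun ij (_ : ij ∈ Finset.univ) => h1 ij
  simp only [Finset.sum_sub_distrib, Finset.sum_add_distrib, ← Finset.mul_sum] at h4
  have h5 : ∑ ij, ((marginalMatrixStar N)ᵀ *ᵥ u) ij * (π ij - gibbs lam c u ij) = 0 := h0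
  simp only [Set.mem_ofPred_eq, entropicObjective, negEntropy, dotProduct, Finset.sum_sub_distrib,
    Finset.sum_add_distrib]
  linarith

theorem regPlan_eq_of_isRegPlan {N : ℕ} {lam : ℝ} (hlam : 0 < lam) {c π : Fin N × Fin N → ℝ}
    {r s : Fin N → ℝ} (hr : r ∈ stdSimplex ℝ (Fin N)) (hs : s ∈ stdSimplex ℝ (Fin N))
    (h : IsRegPlan lam c r s π) : regPlan lam c r s = π :=
  (existsUnique_isRegPlan hlam c hr hs).unique (isRegPlan_regPlan hlam c hr hs) h

theorem posSimplex_subset_stdSimplex {N : ℕ} {r : Fin N → ℝ} (hr : r ∈ posSimplex N) :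
    r ∈ stdSimplex ℝ (Fin N) := ⟨fun i => (hr.1 i).le, hr.2⟩

/-- The regularized plan between positive marginals is positive. -/
theorem regPlan_pos {N : ℕ} {lam : ℝ} (hlam : 0 < lam) (c : Fin N × Fin N → ℝ)
    {r s : Fin N → ℝ} (hr : r ∈ posSimplex N) (hs : s ∈ posSimplex N) (ij : Fin N × Fin N) :
    0 < regPlan lam c r s ij := by
  obtain ⟨hπ, hmin⟩ := isRegPlan_regPlan hlam c (posSimplex_subset_stdSimplex hr)
    (posSimplex_subset_stdSimplex hs)
  set π := regPlan lam c r s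
  refine (hπ.1 ij).lt_of_ne' fun h0 => ?_
  set q : Fin N × Fin N → ℝ := fun ij => r ij.1 * s ij.2 with hq
  have hqpos : ∀ ij, 0 < q ij := fun ij => mul_pos (hr.1 _) (hs.1 _)
  have hqmem : q ∈ couplings r s := by
    refine ⟨fun ij => (hqpos ij).le, ?_⟩
    ext (i | j)
    · rw [marginalMatrix_mulVec_inl]
      simp [hq, ← Finset.mul_sum, hs.2]
    · rw [marginalMatrix_mulVec_inr]
      simp [hq, ← Finset.sum_mul, hr.2]
  -- along the segment from `π` to `q` the objective has slope `-∞` at `π`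
  have key : ∀ t ∈ Set.Ioo (0 : ℝ) 1,
      0 ≤ (c ⬝ᵥ q - c ⬝ᵥ π + lam * (negEntropy q - negEntropy π)) + lam * q ij * Real.log t := by
    intro t ht
    have hmem : (1 - t) • π + t • q ∈ couplings r s :=
      convex_couplings r s hπ hqmem (by linarith [ht.2]) ht.1.le (by ring)
    have h1 : entropicObjective lam c π ≤ entropicObjective lam c ((1 - t) • π + t • q) := hmin hmem
    have h2 : negEntropy ((1 - t) • π + t • q) ≤
        (1 - t) * negEntropy π + t * negEntropy q + t * q ij * Real.log t := by
      have e : t * q ij * Real.log t = ∑ kl, if kl = ij then t * q ij * Real.log t else 0 := by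
        simp
      unfold negEntropy
      rw [e, Finset.mul_sum, Finset.mul_sum, ← Finset.sum_add_distrib, ← Finset.sum_add_distrib]
      refine Finset.sum_le_sum fun kl _ => ?_
      simp only [Pi.add_apply, Pi.smul_apply, smul_eq_mul]
      split_ifs with hkl
      · subst hkl
        -- At the vanishing entry the segment takes the value `t * q`, whose entropy term contains
        -- the extra summand `t * q * log t`.
        rw [h0, mul_zero, zero_add, Real.log_mul ht.1.ne' (hqpos kl).ne']
        simp
        linarith
      · have := Real.strictConvexOn_mul_log.convexOn.2 (hπ.1 kl) (hqpos kl).le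
          (by linarith [ht.2] : (0 : ℝ) ≤ 1 - t) ht.1.le (by ring)
        simp only [smul_eq_mul] at this
        linarith
    have h3 := mul_le_mul_of_nonneg_left h2 hlam.le
    simp only [entropicObjective, dotProduct_add, dotProduct_smul, smul_eq_mul] at h1
    have h4 : 0 ≤ t * ((c ⬝ᵥ q - c ⬝ᵥ π + lam * (negEntropy q - negEntropy π)) +
        lam * q ij * Real.log t) := by linarith
    exact nonneg_of_mul_nonneg_right h4 ht.1
  have hlim : Tendsto (fun t => (c ⬝ᵥ q - c ⬝ᵥ π + lam * (negEntropy q - negEntropy π)) +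
      lam * q ij * Real.log t) (𝓝[>] 0) atBot :=
    tendsto_atBot_add_const_left _ _
      (Real.tendsto_log_nhdsGT_zero.const_mul_atBot (mul_pos hlam (hqpos ij)))
  obtain ⟨t, ht1, ht2⟩ := ((hlim.eventually (eventually_lt_atBot 0)).and
    (Ioo_mem_nhdsGT (zero_lt_one (α := ℝ)))).exists
  exact absurd (key t ht2) (not_le.2 ht1)

/-- First order condition: `c + lam * log π` is orthogonal to the kernel of the marginal map. -/
theorem regPlan_stationary {N : ℕ} {lam : ℝ} (hlam : 0 < lam) (c : Fin N × Fin N → ℝ)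
    {r s : Fin N → ℝ} (hr : r ∈ posSimplex N) (hs : s ∈ posSimplex N)
    {v : Fin N × Fin N → ℝ} (hv : marginalMatrix N *ᵥ v = 0) :
    ∑ ij, (c ij + lam * Real.log (regPlan lam c r s ij)) * v ij = 0 := by
  have hpos := regPlan_pos hlam c hr hs
  obtain ⟨hπ, hmin⟩ := isRegPlan_regPlan hlam c (posSimplex_subset_stdSimplex hr)
    (posSimplex_subset_stdSimplex hs)
  set π := regPlan lam c r s
  have hmem : ∀ᶠ t : ℝ in 𝓝 0, π + t • v ∈ couplings r s := by
    have : ∀ᶠ t : ℝ in 𝓝 0, ∀ ij, 0 < (π + t • v) ij := by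
      refine eventually_all.2 fun ij => ?_
      have hc : Continuous fun t : ℝ => (π + t • v) ij := by
        simp only [Pi.add_apply, Pi.smul_apply, smul_eq_mul]
        fun_prop
      exact hc.continuousAt.eventually (lt_mem_nhds (by simpa using hpos ij))
    filter_upwards [this] with t ht
    exact ⟨fun ij => (ht ij).le, by rw [Matrix.mulVec_add, Matrix.mulVec_smul, hv, hπ.2]; simp⟩
  -- Positivity of the plan allows perturbations of both signs, so the one-variable derivative
  -- vanishes.
  have hloc : IsLocalMin (fun t : ℝ => entropicObjective lam c (π + t • v)) 0 := by
    filter_upwards [hmem] with t ht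
    have := hmin ht
    simpa using this
  have hder : HasDerivAt (fun t : ℝ => entropicObjective lam c (π + t • v))
      (∑ ij, (c ij + lam * Real.log (π ij)) * v ij) 0 := by
    have h1 : ∀ ij, HasDerivAt (fun t : ℝ => π ij + t * v ij) (v ij) 0 := fun ij => by
      simpa using ((hasDerivAt_id (0 : ℝ)).mul_const (v ij)).const_add (π ij)
    have h2 : ∀ ij, HasDerivAt (fun t : ℝ => c ij * (π ij + t * v ij) +
        lam * ((π ij + t * v ij) * Real.log (π ij + t * v ij) - (π ij + t * v ij) + 1))
        ((c ij + lam * Real.log (π ij)) * v ij) 0 := fun ij => by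
      have hl := ((Real.hasDerivAt_mul_log (x := π ij + 0 * v ij)
        (by simpa using (hpos ij).ne')).comp (0 : ℝ) (h1 ij))
      have := ((h1 ij).const_mul (c ij)).add (((hl.sub (h1 ij)).add_const 1).const_mul lam)
      refine this.congr_deriv ?_
      simp only [zero_mul, add_zero]
      ring
    have h3 := HasDerivAt.fun_sum fun ij (_ : ij ∈ Finset.univ) => h2 ij
    have e : (fun t : ℝ => entropicObjective lam c (π + t • v)) = fun t => ∑ ij,
        (c ij * (π ij + t * v ij) +
        lam * ((π ij + t * v ij) * Real.log (π ij + t * v ij) - (π ij + t * v ij) + 1)) := by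
      ext t
      rw [Finset.sum_add_distrib, ← Finset.mul_sum]
      rfl
    rw [e]
    exact h3
  exact hloc.hasDerivAt_eq_zero hder

/-- The regularized plan between positive marginals has Gibbs form. -/
theorem exists_regPlan_eq_gibbs {N : ℕ} {lam : ℝ} (hlam : 0 < lam)
    (c : Fin (N + 1) × Fin (N + 1) → ℝ) {r s : Fin (N + 1) → ℝ} (hr : r ∈ posSimplex (N + 1))
    (hs : s ∈ posSimplex (N + 1)) : ∃ u, regPlan lam c r s = gibbs lam c u := by
  set π := regPlan lam c r s with hπ
  set g : Fin (N + 1) × Fin (N + 1) → ℝ := fun ij => c ij + lam * Real.log (π ij) with hg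
  have hrect : ∀ i j, g (i, j) - g (i, Fin.last N) - g (0, j) + g (0, Fin.last N) = 0 := by
    intro i j
    -- Signed unit masses at the corners of a rectangle have zero marginals. Stationarity along them
    -- makes `g` a sum of a function of the row and a function of the column.
    set v : Fin (N + 1) × Fin (N + 1) → ℝ := Pi.single (i, j) 1 - Pi.single (i, Fin.last N) 1 -
      Pi.single (0, j) 1 + Pi.single (0, Fin.last N) 1 with hvdef
    have hv : marginalMatrix (N + 1) *ᵥ v = 0 := by
      simp only [hvdef, Matrix.mulVec_add, Matrix.mulVec_sub, Matrix.mulVec_single_one]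
      ext (a | a) <;> simp [marginalMatrix, Matrix.col]
    have h := regPlan_stationary hlam c hr hs hv
    have e : ∑ ij, g ij * v ij = g (i, j) - g (i, Fin.last N) - g (0, j) + g (0, Fin.last N) := by
      simp [hvdef, mul_add, mul_sub, Finset.sum_add_distrib, Finset.sum_sub_distrib,
        Pi.single_apply]
    rw [← e]
    exact h
  -- The additive decomposition of `g`, normalized so that the potential of the deleted last column
  -- is zero.
  refine ⟨Sum.elim (fun i => g (i, Fin.last N))
    (fun j => g (0, j.castSucc) - g (0, Fin.last N)), ?_⟩
  ext ⟨i, j⟩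
  have hpos := regPlan_pos hlam c hr hs (i, j)
  have hAu : ((marginalMatrixStar N)ᵀ *ᵥ Sum.elim (fun i => g (i, Fin.last N))
      (fun j => g (0, j.castSucc) - g (0, Fin.last N))) (i, j) = g (i, j) := by
    induction j using Fin.lastCases with
    | last => rw [marginalMatrixStar_transpose_mulVec_last, Sum.elim_inl]
    | cast j =>
      rw [marginalMatrixStar_transpose_mulVec_castSucc, Sum.elim_inl, Sum.elim_inr]
      linarith [hrect i j.castSucc]
  rw [gibbs, hAu]
  have e : (g (i, j) - c (i, j)) / lam = Real.log (π (i, j)) := by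
    simp only [hg]
    field_simp
    ring
  rw [e, Real.exp_log hpos]

/-- A positive diagonal matrix conjugated by an injective map is positive definite. -/
theorem isUnit_star_mul_diagonal_mul_star {N : ℕ} {π : Fin (N + 1) × Fin (N + 1) → ℝ}
    (hπ : ∀ ij, 0 < π ij) :
    IsUnit (marginalMatrixStar N * Matrix.diagonal π * (marginalMatrixStar N)ᵀ) := by
  have h : (Matrix.diagonal π).PosDef := Matrix.PosDef.diagonal hπ
  have := h.conjTranspose_mul_mul_same (marginalMatrixStar_transpose_injective N)
  simpa [Matrix.conjTranspose_eq_transpose_of_trivial] using this.isUnit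

/-! ### Differentiability of the plan and uniform expansion of the distance. -/

/-- A strictly differentiable map of the cost vector and the reduced marginals that coincides with
the regularized plan near a positive pair of marginals. -/
theorem exists_hasStrictFDerivAt_regPlan {N : ℕ} {lam : ℝ} (hlam : 0 < lam)
    (c₀ : Fin (N + 1) × Fin (N + 1) → ℝ) {r s : Fin (N + 1) → ℝ} (hr : r ∈ posSimplex (N + 1))
    (hs : s ∈ posSimplex (N + 1)) :
    ∃ (F : (Fin (N + 1) × Fin (N + 1) → ℝ) × (Fin (N + 1) ⊕ Fin N → ℝ) →
          (Fin (N + 1) × Fin (N + 1) → ℝ))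
      (F' : (Fin (N + 1) × Fin (N + 1) → ℝ) × (Fin (N + 1) ⊕ Fin N → ℝ) →L[ℝ]
          (Fin (N + 1) × Fin (N + 1) → ℝ)),
      HasStrictFDerivAt F F' (c₀, Sum.elim r (dropLast s)) ∧
      (∀ h, F' (0, h) = (Matrix.diagonal (regPlan lam c₀ r s) * (marginalMatrixStar N)ᵀ *
        (marginalMatrixStar N * Matrix.diagonal (regPlan lam c₀ r s) *
          (marginalMatrixStar N)ᵀ)⁻¹) *ᵥ h) ∧
      ∀ᶠ q in 𝓝 (c₀, Sum.elim r (dropLast s)), ∀ r' ∈ stdSimplex ℝ (Fin (N + 1)),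
        ∀ s' ∈ stdSimplex ℝ (Fin (N + 1)), q.2 = Sum.elim r' (dropLast s') →
          regPlan lam q.1 r' s' = F q := by
  obtain ⟨u₀, hu₀⟩ := exists_regPlan_eq_gibbs hlam c₀ hr hs
  have hplan := isRegPlan_regPlan hlam c₀ (posSimplex_subset_stdSimplex hr)
    (posSimplex_subset_stdSimplex hs)
  have hb₀ : marginalMatrixStar N *ᵥ gibbs lam c₀ u₀ = Sum.elim r (dropLast s) := by
    rw [← hu₀]
    exact (couplings_iff_star (hr.2.trans hs.2.symm) _).1 hplan.1.2
  rw [hu₀]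
  have hunit := isUnit_star_mul_diagonal_mul_star (gibbs_pos lam c₀ u₀)
  set A := marginalMatrixStar N with hA
  set D := Matrix.diagonal (gibbs lam c₀ u₀) with hD
  let V := Fin (N + 1) × Fin (N + 1) → ℝ
  let U := Fin (N + 1) ⊕ Fin N → ℝ
  let ℓ : V × U →L[ℝ] V := lam⁻¹ • ((Matrix.toLin' Aᵀ).toContinuousLinearMap.comp
    (ContinuousLinearMap.snd ℝ V U) - ContinuousLinearMap.fst ℝ V U)
  have hℓ : ∀ q : V × U, ℓ q = lam⁻¹ • (Aᵀ *ᵥ q.2 - q.1) := fun q => by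
    simp [ℓ]
  let g : V × U → V := fun q => gibbs lam q.1 q.2
  have hg : HasStrictFDerivAt g ((Matrix.toLin' D).toContinuousLinearMap.comp ℓ) (c₀, u₀) := by
    rw [hasStrictFDerivAt_pi']
    intro ij
    have h1 : HasStrictFDerivAt (fun q => ℓ q ij)
        ((ContinuousLinearMap.proj (R := ℝ) (φ := fun _ => ℝ) ij).comp ℓ) (c₀, u₀) :=
      ContinuousLinearMap.hasStrictFDerivAt
        ((ContinuousLinearMap.proj (R := ℝ) (φ := fun _ => ℝ) ij).comp ℓ)
    have e : ∀ q : V × U, g q ij = Real.exp (ℓ q ij) := fun q => by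
      simp only [g, gibbs, hℓ, Pi.smul_apply, smul_eq_mul, div_eq_inv_mul, hA]
      rfl
    have h2 := h1.exp
    rw [← e] at h2
    rw [show (fun q => g q ij) = fun q => Real.exp (ℓ q ij) from funext e]
    refine h2.congr_fderiv ?_
    ext q <;> simp [hD, Matrix.mulVec_diagonal, g]
  -- Carrying the cost along as first component turns the marginal equation into an endomorphism of
  -- `V × U`, so the inverse function theorem solves for the potential as a function of cost and
  -- marginals.
  have hΘ : HasStrictFDerivAt (fun q : V × U => (q.1, A *ᵥ g q))
      ((ContinuousLinearMap.fst ℝ V U).prod ((Matrix.toLin' A).toContinuousLinearMap.comp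
        ((Matrix.toLin' D).toContinuousLinearMap.comp ℓ))) (c₀, u₀) := by
    refine hasStrictFDerivAt_fst.prodMk ?_
    exact ((Matrix.toLin' A).toContinuousLinearMap.hasStrictFDerivAt (x := g (c₀, u₀))).comp
      (c₀, u₀) hg
  set Θ' := (ContinuousLinearMap.fst ℝ V U).prod ((Matrix.toLin' A).toContinuousLinearMap.comp
        ((Matrix.toLin' D).toContinuousLinearMap.comp ℓ)) with hΘ'
  have hΘ'apply : ∀ q : V × U, Θ' q = (q.1, A *ᵥ (D *ᵥ (lam⁻¹ • (Aᵀ *ᵥ q.2 - q.1)))) := fun q => by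
    rw [← hℓ]
    rfl
  have hinv : ∀ w : U, (A * D * Aᵀ) *ᵥ ((A * D * Aᵀ)⁻¹ *ᵥ w) = w := fun w => by
    rw [Matrix.mulVec_mulVec, Matrix.mul_nonsing_inv _ ((Matrix.isUnit_iff_isUnit_det _).1 hunit),
      Matrix.one_mulVec]
  -- The derivative is block triangular: the cost component is the identity, and the remaining block
  -- is `lam⁻¹ • (A * D * Aᵀ)`.
  have hinj : Function.Injective (Θ' : V × U →ₗ[ℝ] V × U) := by
    rw [← LinearMap.ker_eq_bot, LinearMap.ker_eq_bot']
    rintro ⟨dc, du⟩ h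
    have h' : Θ' (dc, du) = 0 := h
    rw [hΘ'apply] at h'
    obtain ⟨h1, h2⟩ := Prod.mk.inj h'
    simp only at h1 h2
    subst h1
    rw [sub_zero, Matrix.mulVec_smul, Matrix.mulVec_smul, smul_eq_zero] at h2
    have h3 := h2.resolve_left (inv_ne_zero hlam.ne')
    rw [Matrix.mulVec_mulVec, Matrix.mulVec_mulVec] at h3
    have h4 := Matrix.mulVec_injective_of_isUnit hunit (h3.trans (Matrix.mulVec_zero _).symm)
    rw [h4]
    rfl
  let e : (V × U) ≃L[ℝ] (V × U) :=
    (LinearEquiv.ofInjectiveEndo (Θ' : V × U →ₗ[ℝ] V × U) hinj).toContinuousLinearEquiv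
  have he : ∀ q, e q = Θ' q := fun q => rfl
  have hΘe : HasStrictFDerivAt (fun q : V × U => (q.1, A *ᵥ g q)) (e : V × U →L[ℝ] V × U)
      (c₀, u₀) := hΘ.congr_fderiv (ContinuousLinearMap.ext fun q => rfl)
  have hval : ((c₀, u₀).1, A *ᵥ g (c₀, u₀)) = (c₀, Sum.elim r (dropLast s)) :=
    Prod.ext rfl hb₀
  have hS := hΘe.to_localInverse
  have hright := hΘe.eventually_right_inverse
  have hSval := hΘe.localInverse_apply_image
  set S := hΘe.localInverse (fun q : V × U => (q.1, A *ᵥ g q)) e (c₀, u₀)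
  rw [hval] at hS hright hSval
  rw [← hSval] at hg
  refine ⟨g ∘ S, _, hg.comp _ hS, fun h => ?_, ?_⟩
  -- The factor `lam` in the derivative of the potential cancels against `lam⁻¹` in `ℓ`.
  · have hsymm : e.symm (0, h) = (0, lam • ((A * D * Aᵀ)⁻¹ *ᵥ h)) := by
      rw [ContinuousLinearEquiv.symm_apply_eq, he, hΘ'apply]
      simp only [sub_zero, Matrix.mulVec_smul, smul_smul, inv_mul_cancel₀ hlam.ne', one_smul]
      rw [Matrix.mulVec_mulVec, Matrix.mulVec_mulVec, hinv]
    have : ((((Matrix.toLin' D).toContinuousLinearMap.comp ℓ).comp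
        (e.symm : V × U →L[ℝ] V × U)) (0, h)) = D *ᵥ ℓ (e.symm (0, h)) := rfl
    rw [this, hsymm, hℓ]
    simp only [sub_zero, Matrix.mulVec_smul, smul_smul, inv_mul_cancel₀ hlam.ne', one_smul]
    rw [Matrix.mulVec_mulVec, Matrix.mulVec_mulVec]
  -- The local inverse yields a Gibbs vector with the prescribed reduced marginals, and the Gibbs
  -- form is sufficient for optimality, so no positivity of the nearby marginals has to be checked.
  · filter_upwards [hright] with q hq r' hr' s' hs' hqb
    obtain ⟨h1, h2⟩ := Prod.mk.inj (hq : ((S q).1, A *ᵥ g (S q)) = (q.1, q.2))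
    refine regPlan_eq_of_isRegPlan hlam hr' hs' ?_
    have h3 : (g ∘ S) q = gibbs lam q.1 (S q).2 := by
      rw [← h1]
      rfl
    rw [h3]
    refine isRegPlan_gibbs hlam (hr'.2.trans hs'.2.symm) ?_
    rw [← h3, ← hqb]
    exact h2

/-- The reduced marginals of a pair of marginals. -/
def reduced {N : ℕ} (a : (Fin (N + 1) → ℝ) × (Fin (N + 1) → ℝ)) : Fin (N + 1) ⊕ Fin N → ℝ :=
  Sum.elim a.1 (dropLast a.2)

theorem continuous_reduced {N : ℕ} : Continuous (reduced (N := N)) := by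
  refine continuous_pi fun i => ?_
  rcases i with i | i
  · exact (continuous_apply i).comp continuous_fst
  · exact (continuous_apply i.castSucc).comp continuous_snd

theorem reduced_sub {N : ℕ} (a b : (Fin (N + 1) → ℝ) × (Fin (N + 1) → ℝ)) :
    reduced (a - b) = reduced a - reduced b := by
  ext (i | i) <;> rfl

theorem norm_reduced_le {N : ℕ} (a : (Fin (N + 1) → ℝ) × (Fin (N + 1) → ℝ)) :
    ‖reduced a‖ ≤ ‖a‖ := by
  refine (pi_norm_le_iff_of_nonneg (norm_nonneg _)).2 fun i => ?_
  rcases i with i | i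
  · exact (norm_le_pi_norm a.1 i).trans (norm_fst_le a)
  · exact (norm_le_pi_norm a.2 i.castSucc).trans (norm_snd_le a)

/-- The pairs of probability vectors. -/
def simplexPairs (N : ℕ) : Set ((Fin (N + 1) → ℝ) × (Fin (N + 1) → ℝ)) :=
  stdSimplex ℝ (Fin (N + 1)) ×ˢ stdSimplex ℝ (Fin (N + 1))

theorem tendsto_cost_reduced {N : ℕ} (c₀ : Fin (N + 1) × Fin (N + 1) → ℝ)
    (a : (Fin (N + 1) → ℝ) × (Fin (N + 1) → ℝ)) :
    Tendsto (fun q : (Fin (N + 1) × Fin (N + 1) → ℝ) × ((Fin (N + 1) → ℝ) × (Fin (N + 1) → ℝ)) =>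
      (q.1, reduced q.2)) (𝓝 c₀ ×ˢ 𝓝[simplexPairs N] a) (𝓝 (c₀, reduced a)) := by
  have h : Continuous fun q : (Fin (N + 1) × Fin (N + 1) → ℝ) ×
      ((Fin (N + 1) → ℝ) × (Fin (N + 1) → ℝ)) => (q.1, reduced q.2) :=
    continuous_fst.prodMk (continuous_reduced.comp continuous_snd)
  have := h.tendsto (c₀, a)
  rw [nhds_prod_eq] at this
  exact this.mono_left (Filter.prod_mono le_rfl nhdsWithin_le_nhds)

/-- Joint continuity of the regularized plan at positive marginals. -/
theorem tendsto_regPlan {N : ℕ} {lam : ℝ} (hlam : 0 < lam)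
    (c₀ : Fin (N + 1) × Fin (N + 1) → ℝ) {r s : Fin (N + 1) → ℝ} (hr : r ∈ posSimplex (N + 1))
    (hs : s ∈ posSimplex (N + 1)) :
    Tendsto (fun q : (Fin (N + 1) × Fin (N + 1) → ℝ) ×
        ((Fin (N + 1) → ℝ) × (Fin (N + 1) → ℝ)) => regPlan lam q.1 q.2.1 q.2.2)
      (𝓝 c₀ ×ˢ 𝓝[simplexPairs N] (r, s)) (𝓝 (regPlan lam c₀ r s)) := by
  obtain ⟨F, F', hF, -, hev⟩ := exists_hasStrictFDerivAt_regPlan hlam c₀ hr hs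
  have hval : regPlan lam c₀ r s = F (c₀, Sum.elim r (dropLast s)) :=
    hev.self_of_nhds r (posSimplex_subset_stdSimplex hr) s (posSimplex_subset_stdSimplex hs) rfl
  rw [hval]
  have ht := tendsto_cost_reduced c₀ (r, s)
  refine (hF.continuousAt.tendsto.comp ht).congr' ?_
  filter_upwards [ht.eventually hev,
    prod_mem_prod univ_mem (self_mem_nhdsWithin (a := (r, s)) (s := simplexPairs N))] with q hq hq2
  exact (hq q.2.1 hq2.2.1 q.2.2 hq2.2.2 rfl).symm

/-- Uniform first order expansion of the regularized distance in the marginals. -/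
theorem eventually_abs_rpow_sub_le {N p : ℕ} {lam : ℝ} (hlam : 0 < lam)
    (c₀ : Fin (N + 1) × Fin (N + 1) → ℝ) {r s : Fin (N + 1) → ℝ} (hr : r ∈ posSimplex (N + 1))
    (hs : s ∈ posSimplex (N + 1)) (hpos : 0 < c₀ ⬝ᵥ regPlan lam c₀ r s) {ε : ℝ} (hε : 0 < ε) :
    ∀ᶠ q in 𝓝 c₀ ×ˢ 𝓝[simplexPairs N] (r, s),
      |(q.1 ⬝ᵥ regPlan lam q.1 q.2.1 q.2.2) ^ ((1 : ℝ) / (p : ℝ)) -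
        (q.1 ⬝ᵥ regPlan lam q.1 r s) ^ ((1 : ℝ) / (p : ℝ)) -
        sensitivityVec p c₀ (regPlan lam c₀ r s) ⬝ᵥ reduced (q.2 - (r, s))| ≤
      ε * ‖q.2 - (r, s)‖ := by
  obtain ⟨F, F', hF, hF', hev⟩ := exists_hasStrictFDerivAt_regPlan hlam c₀ hr hs
  have hval : regPlan lam c₀ r s = F (c₀, Sum.elim r (dropLast s)) :=
    hev.self_of_nhds r (posSimplex_subset_stdSimplex hr) s (posSimplex_subset_stdSimplex hs) rfl
  let V := Fin (N + 1) × Fin (N + 1) → ℝ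
  let U := Fin (N + 1) ⊕ Fin N → ℝ
  have hdot : HasStrictFDerivAt (fun q : V × U => q.1 ⬝ᵥ F q)
      (∑ ij, ((c₀ ij) • (ContinuousLinearMap.proj (R := ℝ) (φ := fun _ => ℝ) ij).comp F' +
        (F (c₀, Sum.elim r (dropLast s)) ij) • (ContinuousLinearMap.proj (R := ℝ)
          (φ := fun _ => ℝ) ij).comp (ContinuousLinearMap.fst ℝ V U)))
      (c₀, Sum.elim r (dropLast s)) := by
    refine HasStrictFDerivAt.fun_sum fun ij _ => ?_
    have h1 : HasStrictFDerivAt (fun q : V × U => q.1 ij) ((ContinuousLinearMap.proj (R := ℝ)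
          (φ := fun _ => ℝ) ij).comp (ContinuousLinearMap.fst ℝ V U))
          (c₀, Sum.elim r (dropLast s)) :=
      ContinuousLinearMap.hasStrictFDerivAt ((ContinuousLinearMap.proj (R := ℝ)
          (φ := fun _ => ℝ) ij).comp (ContinuousLinearMap.fst ℝ V U))
    have h2 := hasStrictFDerivAt_pi'.1 hF ij
    exact h1.mul h2
  have hpow := hdot.rpow_const (p := (1 : ℝ) / (p : ℝ)) (Or.inl (by rw [← hval]; exact hpos.ne'))
  have ht := tendsto_cost_reduced c₀ (r, s)
  have hrs : (r, s) ∈ simplexPairs N :=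
    ⟨posSimplex_subset_stdSimplex hr, posSimplex_subset_stdSimplex hs⟩
  -- Strict differentiability compares two moving points. They are taken with the same cost, at the
  -- marginals `q.2` and `(r, s)`, so the increment in the cost is zero and the expansion is uniform
  -- in nearby costs.
  have ht0 : Tendsto (fun q : V × ((Fin (N + 1) → ℝ) × (Fin (N + 1) → ℝ)) =>
      (q.1, reduced (r, s))) (𝓝 c₀ ×ˢ 𝓝[simplexPairs N] (r, s)) (𝓝 (c₀, reduced (r, s))) :=
    tendsto_fst.prodMk_nhds tendsto_const_nhds
  have hpair := ht.prodMk_nhds ht0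
  filter_upwards [ht.eventually hev, ht0.eventually hev,
    prod_mem_prod univ_mem (self_mem_nhdsWithin (a := (r, s)) (s := simplexPairs N)),
    hpair.eventually (hpow.isLittleO.def hε)] with q hq1 hq2 hq3 hq4
  rw [hq1 q.2.1 hq3.2.1 q.2.2 hq3.2.2 rfl, hq2 r hrs.1 s hrs.2 rfl]
  have e1 : ((q.1, reduced q.2) : V × U) - (q.1, reduced (r, s)) =
      (0, reduced (q.2 - (r, s))) := by
    rw [reduced_sub, Prod.mk_sub_mk, sub_self]
  simp only [Real.norm_eq_abs] at hq4
  rw [e1] at hq4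
  have e2 : ‖((0, reduced (q.2 - (r, s))) : V × U)‖ ≤ ‖q.2 - (r, s)‖ := by
    rw [Prod.norm_mk, norm_zero, max_eq_right (norm_nonneg _)]
    exact norm_reduced_le _
  refine le_trans (le_of_eq ?_) (hq4.trans (mul_le_mul_of_nonneg_left e2 hε.le))
  congr 2
  rw [sensitivityVec, ← Matrix.dotProduct_mulVec, ← hF']
  simp only [gammaVec, dotProduct, hval, Pi.smul_apply, smul_eq_mul, Finset.mul_sum,
    _root_.smul_apply, FunLike.coe_smul, FunLike.coe_sum, Finset.sum_apply, FunLike.coe_add,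
    Pi.add_apply, ContinuousLinearMap.comp_apply, ContinuousLinearMap.proj_apply,
    ContinuousLinearMap.coe_fst', mul_assoc]
  refine Finset.sum_congr rfl fun ij _ => ?_
  rw [show (0 : V) ij = 0 from rfl]
  ring

/-! ### Danskin's theorem for maxima over compact sets. -/

section Danskin

variable {T V : Type*} [TopologicalSpace T]

/-- Finitely many neighbourhoods cover `K`, and finitely many eventual statements hold together.
This upgrades the local estimates in the direction to global ones. -/
theorem eventually_forall_mem_of_isCompact {K : Set T} (hK : IsCompact K) {l : Filter V}
    {P : T → V → Prop} (h : ∀ E ∈ K, ∀ᶠ q in 𝓝[K] E ×ˢ l, P q.1 q.2) :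
    ∀ᶠ b in l, ∀ E ∈ K, P E b := by
  refine hK.induction_on (p := fun S => ∀ᶠ b in l, ∀ E ∈ S, P E b) (by simp)
    (fun S S' hS h => h.mono fun b hb E hE => hb E (hS hE)) (fun S S' h h' => ?_) fun E hE => ?_
  · filter_upwards [h, h'] with b hb hb' E hE
    exact hE.elim (hb E) (hb' E)
  · obtain ⟨pa, ha, pb, hb, hab⟩ := eventually_prod_iff.1 (h E hE)
    exact ⟨{E | pa E}, ha, hb.mono fun b hb E hE => hab hE hb⟩

/-- Danskin's theorem: first order expansion of a maximum over a compact set, from locally uniform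
first order expansions at the maximizers. -/
theorem eventually_abs_isGreatest_sub_le [NormedAddCommGroup V] {K : Set T} (hK : IsCompact K)
    {B : Set V} {b₀ : V} {W : T → V → ℝ} {M : V → ℝ} (hb₀ : b₀ ∈ B)
    (hM : ∀ b ∈ B, IsGreatest ((fun E => W E b) '' K) (M b)) {Ψ : Set T}
    (hΨ : Ψ = {E ∈ K | W E b₀ = M b₀}) (hΨK : IsCompact Ψ)
    (hcont : ∀ E₀ ∈ K, Tendsto (fun q : T × V => W q.1 q.2) (𝓝 E₀ ×ˢ 𝓝[B] b₀) (𝓝 (W E₀ b₀)))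
    {L : T → V → ℝ} {φ : V → ℝ} (hφ : ∀ h, IsGreatest ((fun E => L E h) '' Ψ) (φ h))
    (hdiff : ∀ E₀ ∈ Ψ, ∀ ε > 0, ∀ᶠ q in 𝓝 E₀ ×ˢ 𝓝[B] b₀,
      |W q.1 q.2 - W q.1 b₀ - L E₀ (q.2 - b₀)| ≤ ε * ‖q.2 - b₀‖)
    (hL : ∀ E₀ ∈ Ψ, ∀ ε > 0, ∀ᶠ E in 𝓝[Ψ] E₀, ∀ h, |L E h - L E₀ h| ≤ ε * ‖h‖)
    {C : ℝ} (hC : ∀ h, -(C * ‖h‖) ≤ φ h) {ε : ℝ} (hε : 0 < ε) :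
    ∀ᶠ b in 𝓝[B] b₀, |M b - M b₀ - φ (b - b₀)| ≤ ε * ‖b - b₀‖ := by
  have hmem : ∀ {E}, E ∈ Ψ ↔ E ∈ K ∧ W E b₀ = M b₀ := fun {E} => by rw [hΨ]; rfl
  have hle : ∀ {b E}, b ∈ B → E ∈ K → W E b ≤ M b := fun hb hE =>
    (hM _ hb).2 (Set.mem_image_of_mem _ hE)
  have hupper : ∀ᶠ b in 𝓝[B] b₀, ∀ E ∈ K, W E b ≤ M b₀ + φ (b - b₀) + ε * ‖b - b₀‖ := by
    refine eventually_forall_mem_of_isCompact hK fun E₀ hE₀ => ?_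
    have hKmem : ∀ᶠ q in 𝓝[K] E₀ ×ˢ 𝓝[B] b₀, q.1 ∈ K :=
      tendsto_fst.eventually self_mem_nhdsWithin
    have hmono : 𝓝[K] E₀ ×ˢ 𝓝[B] b₀ ≤ 𝓝 E₀ ×ˢ 𝓝[B] b₀ :=
      Filter.prod_mono nhdsWithin_le_nhds le_rfl
    by_cases hE : E₀ ∈ Ψ
    -- Directions near an optimal `E₀` need not be optimal: `W E b₀ ≤ M b₀` suffices, and the
    -- derivative is taken at `E₀` itself.
    · filter_upwards [hmono (hdiff E₀ hE ε hε), hKmem] with q hq hqK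
      have h1 := (abs_le.1 hq).2
      have h2 := (hφ (q.2 - b₀)).2 (Set.mem_image_of_mem _ hE)
      have h3 := hle hb₀ hqK
      linarith
    · have hlt : W E₀ b₀ < M b₀ := (hle hb₀ hE₀).lt_of_ne fun h => hE (hmem.2 ⟨hE₀, h⟩)
      -- Near a non-optimal direction there is a gap below `M b₀`, which the perturbation, of order
      -- `C * ‖b - b₀‖`, cannot close.
      obtain ⟨μ, h1, h2⟩ := exists_between hlt
      have hn : Tendsto (fun b : V => C * ‖b - b₀‖) (𝓝[B] b₀) (𝓝 0) := by
        have : Continuous fun b : V => C * ‖b - b₀‖ := by fun_prop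
        have := this.tendsto b₀
        rw [sub_self, norm_zero, mul_zero] at this
        exact this.mono_left nhdsWithin_le_nhds
      filter_upwards [hmono ((hcont E₀ hE₀).eventually (gt_mem_nhds h1)),
        tendsto_snd.eventually (hn.eventually (gt_mem_nhds (sub_pos.2 h2)))] with q hq hq2
      have hq' : W q.1 q.2 < μ := hq
      have := hC (q.2 - b₀)
      have := mul_nonneg hε.le (norm_nonneg (q.2 - b₀))
      linarith
  -- On `Ψ` half of `ε` pays for the expansion at `E₀`, the other half for replacing `L E₀` by `L
  -- E`; then `E` may be chosen to attain `φ (b - b₀)`.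
  have hlower : ∀ᶠ b in 𝓝[B] b₀, ∀ E ∈ Ψ, M b₀ + L E (b - b₀) - ε * ‖b - b₀‖ ≤ W E b := by
    refine eventually_forall_mem_of_isCompact hΨK fun E₀ hE₀ => ?_
    filter_upwards [Filter.prod_mono nhdsWithin_le_nhds le_rfl (hdiff E₀ hE₀ _ (half_pos hε)),
      tendsto_fst.eventually (hL E₀ hE₀ _ (half_pos hε)),
      tendsto_fst.eventually (self_mem_nhdsWithin (a := E₀) (s := Ψ))] with q hq hq2 hq3
    have h1 := (abs_le.1 hq).1
    have h2 := (abs_le.1 (hq2 (q.2 - b₀))).2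
    have h3 := (hmem.1 hq3).2
    linarith
  filter_upwards [hupper, hlower, self_mem_nhdsWithin] with b hb hb2 hbB
  rw [abs_le]
  constructor
  · obtain ⟨E, hE, hE2⟩ := (hφ (b - b₀)).1
    have := hb2 E hE
    have := hle hbB (hmem.1 hE).1
    simp only at hE2
    linarith
  · obtain ⟨E, hE, hE2⟩ := (hM b hbB).1
    have := hb E hE
    simp only at hE2
    linarith

end Danskin

/-! ### Optimal directions and the directional derivative of the projection robust distance. -/

theorem continuousAt_matrix_inv_of_isUnit {ι : Type*} [Fintype ι] [DecidableEq ι] {A : Matrix ι ι ℝ}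
    (hA : IsUnit A) : ContinuousAt (fun B : Matrix ι ι ℝ => B⁻¹) A := by
  have h : A.det ≠ 0 := ((Matrix.isUnit_iff_isUnit_det A).1 hA).ne_zero
  refine _root_.continuousAt_matrix_inv A ?_
  rw [show (Ring.inverse : ℝ → ℝ) = Inv.inv from funext Ring.inverse_eq_inv]
  exact continuousAt_inv₀ h

/-- A positive cost keeps the power `1 / p - 1` away from its singularity, and a positive plan keeps
the inverted matrix nonsingular. -/
theorem continuousAt_sensitivityVec {N p : ℕ}
    {q : (Fin (N + 1) × Fin (N + 1) → ℝ) × (Fin (N + 1) × Fin (N + 1) → ℝ)}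
    (hπ : ∀ ij, 0 < q.2 ij) (hpos : 0 < q.1 ⬝ᵥ q.2) :
    ContinuousAt (fun q : (Fin (N + 1) × Fin (N + 1) → ℝ) × (Fin (N + 1) × Fin (N + 1) → ℝ) =>
      sensitivityVec p q.1 q.2) q := by
  have hdot : Continuous fun q : (Fin (N + 1) × Fin (N + 1) → ℝ) ×
      (Fin (N + 1) × Fin (N + 1) → ℝ) => q.1 ⬝ᵥ q.2 := continuous_fst.dotProduct continuous_snd
  have hγ : ContinuousAt (fun q : (Fin (N + 1) × Fin (N + 1) → ℝ) ×
      (Fin (N + 1) × Fin (N + 1) → ℝ) => gammaVec p q.1 q.2) q :=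
    (continuousAt_const.mul (hdot.continuousAt.rpow_const (Or.inl hpos.ne'))).smul
      continuousAt_fst
  have hD : Continuous fun q : (Fin (N + 1) × Fin (N + 1) → ℝ) ×
      (Fin (N + 1) × Fin (N + 1) → ℝ) => Matrix.diagonal q.2 := continuous_snd.matrix_diagonal
  have hS : Continuous fun q : (Fin (N + 1) × Fin (N + 1) → ℝ) ×
      (Fin (N + 1) × Fin (N + 1) → ℝ) =>
      marginalMatrixStar N * Matrix.diagonal q.2 * (marginalMatrixStar N)ᵀ :=
    (continuous_const.matrix_mul hD).matrix_mul continuous_const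
  have hinv := ContinuousAt.comp (f := fun q : (Fin (N + 1) × Fin (N + 1) → ℝ) ×
      (Fin (N + 1) × Fin (N + 1) → ℝ) =>
      marginalMatrixStar N * Matrix.diagonal q.2 * (marginalMatrixStar N)ᵀ)
    (continuousAt_matrix_inv_of_isUnit (isUnit_star_mul_diagonal_mul_star hπ)) hS.continuousAt
  have hmul : Continuous fun z : (Fin (N + 1) × Fin (N + 1) → ℝ) ×
      Matrix (Fin (N + 1) × Fin (N + 1)) (Fin (N + 1) ⊕ Fin N) ℝ ×
      Matrix (Fin (N + 1) ⊕ Fin N) (Fin (N + 1) ⊕ Fin N) ℝ => z.1 ᵥ* (z.2.1 * z.2.2) :=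
    continuous_fst.matrix_vecMul (continuous_snd.fst.matrix_mul continuous_snd.snd)
  exact hmul.continuousAt.comp (hγ.prodMk
    ((hD.matrix_mul continuous_const).continuousAt.prodMk hinv))

theorem continuous_costVec_projPts {N d k p : ℕ} (x : Fin N → EuclideanSpace ℝ (Fin d)) :
    Continuous fun E : Matrix (Fin d) (Fin k) ℝ => costVec p (projPts x E) := by
  unfold costVec projPts
  fun_prop

theorem submatrix_one_mem_stiefel {d k : ℕ} {σ : Fin k → Fin d} (hσ : Function.Injective σ) :
    (1 : Matrix (Fin d) (Fin d) ℝ).submatrix id σ ∈ stiefel d k := by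
  show _ = _
  ext i j
  simp only [Matrix.mul_apply, Matrix.transpose_apply, Matrix.submatrix_apply, id, Matrix.one_apply]
  rw [Finset.sum_eq_single (σ i)]
  · simp [hσ.eq_iff]
  · intro b _ hb
    simp [hb]
  · simp

theorem exists_mem_stiefel_projPts_ne {N d k : ℕ} (hk : 1 ≤ k) (hkd : k ≤ d)
    {x : Fin N → EuclideanSpace ℝ (Fin d)} {i j : Fin N} (hij : x i ≠ x j) :
    ∃ E ∈ stiefel d k, projPts x E i ≠ projPts x E j := by
  obtain ⟨a, ha⟩ : ∃ a, x i a ≠ x j a := by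
    by_contra! h
    exact hij (PiLp.ext h)
  let j₀ : Fin k := ⟨0, hk⟩
  -- The transposition puts the separating coordinate `a` into the first of the `k` selected
  -- coordinates.
  let σ : Fin k → Fin d := fun j => Equiv.swap (Fin.castLE hkd j₀) a (Fin.castLE hkd j)
  have hσ : Function.Injective σ := fun u v h =>
    Fin.castLE_injective hkd ((Equiv.swap (Fin.castLE hkd j₀) a).injective h)
  refine ⟨_, submatrix_one_mem_stiefel hσ, fun h => ha ?_⟩
  have h1 := congrArg (fun v : EuclideanSpace ℝ (Fin k) => v j₀) h
  simpa [projPts, Matrix.mulVec, dotProduct, Matrix.one_apply, σ] using h1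

theorem costVec_nonneg {N k p : ℕ} (y : Fin N → EuclideanSpace ℝ (Fin k)) (ij : Fin N × Fin N) :
    0 ≤ costVec p y ij := by
  unfold costVec
  positivity

/-- Optimal directions have positive transport cost, unless there is only one support point. -/
theorem cost_pos_of_mem_optDirs {N d k p : ℕ} (hk : 1 ≤ k) (hkd : k ≤ d) (hp1 : 1 ≤ p)
    {lam : ℝ} (hlam : 0 < lam) {x : Fin (N + 1) → EuclideanSpace ℝ (Fin d)}
    (hx : Function.Injective x) {r s : Fin (N + 1) → ℝ} (hr : r ∈ posSimplex (N + 1))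
    (hs : s ∈ posSimplex (N + 1)) :
    (∀ E : Matrix (Fin d) (Fin k) ℝ, costVec p (projPts x E) = 0) ∨
      ∀ E ∈ optDirs k p lam x r s,
        0 < costVec p (projPts x E) ⬝ᵥ regPlan lam (costVec p (projPts x E)) r s := by
  rcases N.eq_zero_or_pos with rfl | hN
  · left
    intro E
    ext ⟨i, j⟩
    have hij : i = j := Subsingleton.elim (α := Fin 1) i j
    simp only [hij, costVec, sub_self, norm_zero, Pi.zero_apply]
    exact zero_pow (by omega)
  · right
    intro E hE
    have h01 : (0 : Fin (N + 1)) ≠ Fin.last N := by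
      intro h
      have := congrArg Fin.val h
      simp at this
      omega
    obtain ⟨E₁, hE₁, hne⟩ := exists_mem_stiefel_projPts_ne hk hkd (hx.ne h01)
    have hnn : ∀ E : Matrix (Fin d) (Fin k) ℝ, ∀ ij, 0 ≤ costVec p (projPts x E) ij *
        regPlan lam (costVec p (projPts x E)) r s ij := fun E ij =>
      mul_nonneg (costVec_nonneg _ _) (regPlan_pos hlam _ hr hs ij).le
    have h1 : 0 < costVec p (projPts x E₁) ⬝ᵥ regPlan lam (costVec p (projPts x E₁)) r s := by
      refine Finset.sum_pos' (fun ij _ => hnn E₁ ij) ⟨(0, Fin.last N), Finset.mem_univ _, ?_⟩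
      refine mul_pos ?_ (regPlan_pos hlam _ hr hs _)
      exact pow_pos (norm_pos_iff.2 (sub_ne_zero.2 hne)) _
    have h2 : 0 < regW p lam (projPts x E₁) r s := Real.rpow_pos_of_pos h1 _
    have h3 : regW p lam (projPts x E₁) r s ≤ regW p lam (projPts x E) r s := by
      rw [hE.2]
      exact (isGreatest_regPW hkd hlam x (posSimplex_subset_stdSimplex hr)
        (posSimplex_subset_stdSimplex hs)).2 (Set.mem_image_of_mem _ hE₁)
    refine (Finset.sum_nonneg fun ij _ => hnn E ij).lt_of_ne' fun h0 => ?_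
    have h4 : regW p lam (projPts x E) r s = 0 := by
      have h0' : costVec p (projPts x E) ⬝ᵥ regPlan lam (costVec p (projPts x E)) r s = 0 := h0
      rw [regW, h0', Real.zero_rpow]
      positivity
    linarith

theorem abs_dotProduct_le {ι : Type*} [Fintype ι] (v w : ι → ℝ) :
    |v ⬝ᵥ w| ≤ Fintype.card ι * ‖v‖ * ‖w‖ := by
  calc |v ⬝ᵥ w| ≤ ∑ i, |v i * w i| := Finset.abs_sum_le_sum_abs _ _
    _ ≤ ∑ _i : ι, ‖v‖ * ‖w‖ := Finset.sum_le_sum fun i _ => by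
        rw [abs_mul]
        exact mul_le_mul (norm_le_pi_norm v i) (norm_le_pi_norm w i) (abs_nonneg _) (norm_nonneg _)
    _ = Fintype.card ι * ‖v‖ * ‖w‖ := by
        rw [Finset.sum_const, nsmul_eq_mul, Finset.card_univ, mul_assoc]

/-- The maximum of a compact family of linear functionals is positively homogeneous and
continuous. -/
theorem exists_isGreatest_dotProduct_reduced {N : ℕ} {T : Type*} [TopologicalSpace T] {Ψ : Set T}
    (hΨ : IsCompact Ψ) (hne : Ψ.Nonempty) {S : T → Fin (N + 1) ⊕ Fin N → ℝ}
    (hS : ContinuousOn S Ψ) :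
    ∃ (φ : (Fin (N + 1) → ℝ) × (Fin (N + 1) → ℝ) → ℝ) (C : ℝ),
      (∀ h, IsGreatest ((fun E => S E ⬝ᵥ reduced h) '' Ψ) (φ h)) ∧ Continuous φ ∧
      (∀ t : ℝ, 0 ≤ t → ∀ h, φ (t • h) = t * φ h) ∧ ∀ h, -(C * ‖h‖) ≤ φ h := by
  obtain ⟨R, hR⟩ := hΨ.exists_bound_of_continuousOn hS
  have hgr : ∀ h, ∃ m, IsGreatest ((fun E => S E ⬝ᵥ reduced h) '' Ψ) m := fun h =>
    (hΨ.image_of_continuousOn ((continuous_id.dotProduct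
      continuous_const).comp_continuousOn hS)).exists_isGreatest (hne.image _)
  choose φ hφ using hgr
  set C : ℝ := Fintype.card (Fin (N + 1) ⊕ Fin N) * max R 0
  have hbound : ∀ E ∈ Ψ, ∀ h, |S E ⬝ᵥ reduced h| ≤ C * ‖h‖ := fun E hE h => by
    refine (abs_dotProduct_le _ _).trans ?_
    have h1 : ‖S E‖ ≤ max R 0 := (hR E hE).trans (le_max_left _ _)
    have h2 := norm_reduced_le h
    exact mul_le_mul (mul_le_mul_of_nonneg_left h1 (Nat.cast_nonneg _)) h2 (norm_nonneg _)
      (by positivity)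
  -- A maximizer for `h` is a competitor for `h'`, so the maximum inherits the common Lipschitz
  -- constant of the linear functionals.
  have hlip : ∀ h h', φ h - φ h' ≤ C * ‖h - h'‖ := fun h h' => by
    obtain ⟨E, hE, hE2⟩ := (hφ h).1
    have h1 := (hφ h').2 (Set.mem_image_of_mem _ hE)
    have h2 := (abs_le.1 (hbound E hE (h - h'))).2
    rw [reduced_sub, dotProduct_sub] at h2
    simp only at h1 hE2
    linarith
  refine ⟨φ, C, hφ, ?_, fun t ht h => ?_, fun h => ?_⟩
  · have : LipschitzWith C.toNNReal φ := LipschitzWith.of_le_add_mul _ fun h h' => by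
      rw [Real.coe_toNNReal C (by positivity), dist_eq_norm]
      linarith [hlip h h']
    exact this.continuous
  · have e : ∀ E, S E ⬝ᵥ reduced (t • h) = t * (S E ⬝ᵥ reduced h) := fun E => by
      rw [show reduced (t • h) = t • reduced h by ext (i | i) <;> rfl, dotProduct_smul, smul_eq_mul]
    refine (hφ (t • h)).unique ⟨?_, ?_⟩
    · obtain ⟨E, hE, hE2⟩ := (hφ h).1
      refine ⟨E, hE, ?_⟩
      simp only at hE2
      simp only [e, hE2]
    · rintro _ ⟨E, hE, rfl⟩
      simp only [e]
      exact mul_le_mul_of_nonneg_left ((hφ h).2 (Set.mem_image_of_mem _ hE)) ht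
  · obtain ⟨E, hE⟩ := hne
    exact (abs_le.1 (hbound E hE h)).1.trans ((hφ h).2 (Set.mem_image_of_mem _ hE))

/-- The exponent is nonnegative, so continuity survives a zero cost. This serves the non-optimal
directions, where positivity is not available. -/
theorem tendsto_cost_rpow {N p : ℕ} {lam : ℝ} (hlam : 0 < lam)
    (c₀ : Fin (N + 1) × Fin (N + 1) → ℝ) {r s : Fin (N + 1) → ℝ} (hr : r ∈ posSimplex (N + 1))
    (hs : s ∈ posSimplex (N + 1)) :
    Tendsto (fun q : (Fin (N + 1) × Fin (N + 1) → ℝ) ×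
        ((Fin (N + 1) → ℝ) × (Fin (N + 1) → ℝ)) =>
        (q.1 ⬝ᵥ regPlan lam q.1 q.2.1 q.2.2) ^ ((1 : ℝ) / (p : ℝ)))
      (𝓝 c₀ ×ˢ 𝓝[simplexPairs N] (r, s))
      (𝓝 ((c₀ ⬝ᵥ regPlan lam c₀ r s) ^ ((1 : ℝ) / (p : ℝ)))) := by
  have hd : Continuous fun q : (Fin (N + 1) × Fin (N + 1) → ℝ) ×
      (Fin (N + 1) × Fin (N + 1) → ℝ) => q.1 ⬝ᵥ q.2 :=
    continuous_fst.dotProduct continuous_snd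
  have h := (hd.tendsto (c₀, regPlan lam c₀ r s)).comp
    (tendsto_fst.prodMk_nhds (tendsto_regPlan hlam c₀ hr hs))
  exact h.rpow_const (Or.inr (by positivity))

/-- The regularized projection robust distance is directionally differentiable in the marginals,
tangentially to the simplex. -/
theorem exists_directional_expansion_regPW {N d k p : ℕ} (hk : 1 ≤ k) (hkd : k ≤ d) (hp1 : 1 ≤ p)
    {lam : ℝ} (hlam : 0 < lam) {x : Fin (N + 1) → EuclideanSpace ℝ (Fin d)}
    (hx : Function.Injective x) {r s : Fin (N + 1) → ℝ} (hr : r ∈ posSimplex (N + 1))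
    (hs : s ∈ posSimplex (N + 1)) :
    ∃ φ : (Fin (N + 1) → ℝ) × (Fin (N + 1) → ℝ) → ℝ, Continuous φ ∧
      (∀ t : ℝ, 0 ≤ t → ∀ h, φ (t • h) = t * φ h) ∧
      (∀ h, IsGreatest ((fun E => dirDeriv p lam x r s h.1 h.2 E) '' optDirs k p lam x r s)
        (φ h)) ∧
      ∀ ε > 0, ∀ᶠ b in 𝓝[simplexPairs N] (r, s),
        |regPW k p lam x b.1 b.2 - regPW k p lam x r s - φ (b - (r, s))| ≤
          ε * ‖b - (r, s)‖ := by
  have hr' := posSimplex_subset_stdSimplex hr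
  have hs' := posSimplex_subset_stdSimplex hs
  set cE : Matrix (Fin d) (Fin k) ℝ → Fin (N + 1) × Fin (N + 1) → ℝ :=
    fun E => costVec p (projPts x E) with hcE
  have hcont : Continuous cE := continuous_costVec_projPts x
  have hplan : Continuous fun E => regPlan lam (cE E) r s :=
    (continuous_regPlan hlam hr' hs').comp hcont
  have hgr := fun (b : (Fin (N + 1) → ℝ) × (Fin (N + 1) → ℝ)) (hb : b ∈ simplexPairs N) =>
    isGreatest_regPW (k := k) (p := p) hkd hlam x hb.1 hb.2
  have hW : Continuous fun E => regW p lam (projPts x E) r s :=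
    (hcont.dotProduct hplan).rpow_const fun E => Or.inr (by positivity)
  have hΨcl : IsCompact (optDirs k p lam x r s) :=
    (isCompact_stiefel d k).inter_right (isClosed_eq hW continuous_const)
  have hΨne : (optDirs k p lam x r s).Nonempty := by
    obtain ⟨E, hE, hE2⟩ := (hgr (r, s) ⟨hr', hs'⟩).1
    exact ⟨E, hE, hE2⟩
  set S : Matrix (Fin d) (Fin k) ℝ → Fin (N + 1) ⊕ Fin N → ℝ :=
    fun E => sensitivityVec p (cE E) (regPlan lam (cE E) r s) with hSdef
  have hcase := cost_pos_of_mem_optDirs hk hkd hp1 hlam hx hr hs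
  have hSzero : (∀ E, cE E = 0) → ∀ E, S E = 0 := fun h E => by
    simp [S, h, sensitivityVec, gammaVec]
  have hS : ContinuousOn S (optDirs k p lam x r s) := by
    rcases hcase with h0 | hpos
    · exact continuousOn_const.congr fun E _ => hSzero h0 E
    · intro E hE
      exact (ContinuousAt.comp (f := fun E => (cE E, regPlan lam (cE E) r s))
        (continuousAt_sensitivityVec (p := p) (regPlan_pos hlam (cE E) hr hs) (hpos E hE))
        (hcont.prodMk hplan).continuousAt).continuousWithinAt
  obtain ⟨φ, C, hφ, hφc, hφh, hC⟩ := exists_isGreatest_dotProduct_reduced hΨcl hΨne hS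
  refine ⟨φ, hφc, hφh, hφ, fun ε hε => ?_⟩
  have hmap : ∀ E₀, Tendsto (fun q : Matrix (Fin d) (Fin k) ℝ ×
      ((Fin (N + 1) → ℝ) × (Fin (N + 1) → ℝ)) => (cE q.1, q.2))
      (𝓝 E₀ ×ˢ 𝓝[simplexPairs N] (r, s)) (𝓝 (cE E₀) ×ˢ 𝓝[simplexPairs N] (r, s)) := fun E₀ =>
    ((hcont.tendsto E₀).comp tendsto_fst).prodMk tendsto_snd
  refine eventually_abs_isGreatest_sub_le (isCompact_stiefel d k) (B := simplexPairs N)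
    (b₀ := (r, s)) (W := fun E b => regW p lam (projPts x E) b.1 b.2)
    (M := fun b => regPW k p lam x b.1 b.2) ⟨hr', hs'⟩ hgr rfl hΨcl
    (fun E₀ _ => ?_) (L := fun E h => S E ⬝ᵥ reduced h) hφ (fun E₀ hE₀ ε hε => ?_)
    (fun E₀ hE₀ ε hε => ?_) hC hε
  · have h := (tendsto_cost_rpow (p := p) hlam (cE E₀) hr hs).comp (hmap E₀)
    have e : (fun q : Matrix (Fin d) (Fin k) ℝ × ((Fin (N + 1) → ℝ) × (Fin (N + 1) → ℝ)) =>
        regW p lam (projPts x q.1) q.2.1 q.2.2) = fun q =>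
        (cE q.1 ⬝ᵥ regPlan lam (cE q.1) q.2.1 q.2.2) ^ ((1 : ℝ) / (p : ℝ)) := rfl
    rw [e]
    exact h
  · rcases hcase with h0 | hpos
    -- With identically zero cost, all distances equal the same constant and all sensitivity vectors
    -- vanish.
    · refine Eventually.of_forall fun q => ?_
      have h1 : ∀ (E : Matrix (Fin d) (Fin k) ℝ) (a b : Fin (N + 1) → ℝ),
          regW p lam (projPts x E) a b = (0 : ℝ) ^ ((1 : ℝ) / (p : ℝ)) := fun E a b => by
        rw [regW, h0, zero_dotProduct]
      simp only [h1, hSzero h0, zero_dotProduct, sub_self, abs_zero]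
      positivity
    · have h1 := eventually_abs_rpow_sub_le (p := p) hlam (cE E₀) hr hs (hpos E₀ hE₀) hε
      have h2 := (hmap E₀).eventually h1
      exact h2
  · have hn : (0 : ℝ) < (Fintype.card (Fin (N + 1) ⊕ Fin N) : ℝ) := by
      exact_mod_cast (Fintype.card_pos : 0 < Fintype.card (Fin (N + 1) ⊕ Fin N))
    have hbd := abs_dotProduct_le (ι := Fin (N + 1) ⊕ Fin N)
    generalize (Fintype.card (Fin (N + 1) ⊕ Fin N) : ℝ) = n at hn hbd
    filter_upwards [Metric.tendsto_nhds.1 (hS E₀ hE₀).tendsto (ε / n) (div_pos hε hn)] with E hE h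
    rw [dist_eq_norm] at hE
    rw [← sub_dotProduct]
    refine (hbd _ _).trans ?_
    have h2 := norm_reduced_le h
    calc n * ‖S E - S E₀‖ * ‖reduced h‖ ≤ n * (ε / n) * ‖h‖ := by gcongr
      _ = ε * ‖h‖ := by field_simp

/-! ### Weak convergence of independent pairs and the multivariate central limit theorem. -/

section Distribution

variable {Ω Ω' : Type*} [MeasurableSpace Ω] [MeasurableSpace Ω'] {P : Measure Ω}
  [IsProbabilityMeasure P] {Q : Measure Ω'} [IsProbabilityMeasure Q]

/-- Joint convergence in distribution of independent components. -/
theorem tendstoInDistribution_prodMk_of_indepFun {E F κ : Type*} {l : Filter κ}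
    [NormedAddCommGroup E] [MeasurableSpace E] [BorelSpace E] [SecondCountableTopology E]
    [NormedAddCommGroup F] [MeasurableSpace F] [BorelSpace F] [SecondCountableTopology F]
    {U : κ → Ω → E} {V : κ → Ω → F} {G : Ω' → E} {H : Ω' → F}
    (hU : TendstoInDistribution U l G (fun _ => P) Q)
    (hV : TendstoInDistribution V l H (fun _ => P) Q)
    (hUV : ∀ i, IndepFun (U i) (V i) P) (hGH : IndepFun G H Q) :
    TendstoInDistribution (fun i ω => (U i ω, V i ω)) l (fun ω => (G ω, H ω)) (fun _ => P) Q where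
  forall_aemeasurable i := (hU.forall_aemeasurable i).prodMk (hV.forall_aemeasurable i)
  aemeasurable_limit := hU.aemeasurable_limit.prodMk hV.aemeasurable_limit
  tendsto := by
    -- Independence makes the joint laws product measures, and the product is weakly continuous in
    -- its two factors.
    have h := (ProbabilityMeasure.continuous_prod (α := E) (β := F)).continuousAt.tendsto.comp
      (hU.tendsto.prodMk_nhds hV.tendsto)
    refine Tendsto.congr (fun i => Subtype.ext ?_)
      (h.trans (le_of_eq (congrArg 𝓝 (Subtype.ext ?_))))
    · exact ((indepFun_iff_map_prod_eq_prod_map_map (hU.forall_aemeasurable i)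
        (hV.forall_aemeasurable i)).1 (hUV i)).symm
    · exact ((indepFun_iff_map_prod_eq_prod_map_map hU.aemeasurable_limit
        hV.aemeasurable_limit).1 hGH).symm

/-- The multivariate central limit theorem for centered random vectors. -/
theorem tendstoInDistribution_inv_sqrt_smul_sum {ι : Type*} [Fintype ι] [DecidableEq ι]
    {S : Matrix ι ι ℝ} (hS : S.PosSemidef) {G : Ω' → EuclideanSpace ℝ ι}
    (hG : HasLaw G (multivariateGaussian 0 S) Q) {Z : ℕ → Ω → EuclideanSpace ℝ ι}
    (hZ : MemLp (Z 0) 2 P) (hindep : iIndepFun Z P)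
    (hident : ∀ i, IdentDistrib (Z i) (Z 0) P P) (hmean : ∀ t, P[fun ω => inner ℝ (Z 0 ω) t] = 0)
    (hcov : ∀ t : EuclideanSpace ℝ ι, P[fun ω => inner ℝ (Z 0 ω) t ^ 2] = t ⬝ᵥ S *ᵥ t) :
    TendstoInDistribution (fun (n : ℕ) ω => (√n)⁻¹ • ∑ i ∈ Finset.range n, Z i ω) atTop G
      (fun _ => P) Q := by
  have hmeas : ∀ n : ℕ, AEMeasurable (fun ω => (√n)⁻¹ • ∑ i ∈ Finset.range n, Z i ω) P := fun n =>
    (measurable_const_smul (√(n : ℝ))⁻¹).comp_aemeasurable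
      (Finset.aemeasurable_fun_sum _ fun i _ => (hident i).aemeasurable_fst)
  refine ⟨hmeas, hG.aemeasurable, ?_⟩
  refine ProbabilityMeasure.tendsto_iff_tendsto_charFun.2 fun t => ?_
  have hinner : Measurable fun z : EuclideanSpace ℝ ι => (inner ℝ z t : ℝ) := by fun_prop
  have hm : P[fun ω => inner ℝ (Z 0 ω) t] = 0 := hmean t
  have hmem : MemLp (fun ω => (inner ℝ (Z 0 ω) t : ℝ)) 2 P := hZ.inner_const t
  have hvar : Var[fun ω => (inner ℝ (Z 0 ω) t : ℝ); P] = t ⬝ᵥ S *ᵥ t := by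
    rw [variance_of_integral_eq_zero hmem.aestronglyMeasurable.aemeasurable hm]
    exact hcov t
  have hclt := tendstoInDistribution_inv_sqrt_mul_sum_sub (P := P)
    (X := fun i ω => (inner ℝ (Z i ω) t : ℝ))
    (P' := gaussianReal 0 (Var[fun ω => (inner ℝ (Z 0 ω) t : ℝ); P]).toNNReal) HasLaw.id hmem
    (hindep.comp (fun _ z => (inner ℝ z t : ℝ)) fun _ => hinner)
    (fun i => (hident i).comp hinner)
  -- Cramér-Wold: the characteristic function of a random vector at `t` is that of its inner product
  -- with `t` at `1`, so the scalar limit theorem suffices.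
  have hchar := ProbabilityMeasure.tendsto_iff_tendsto_charFun.1 hclt.tendsto 1
  simp only [ProbabilityMeasure.coe_mk] at hchar ⊢
  rw [hG.map_eq, charFun_multivariateGaussian hS]
  rw [Measure.map_id, charFun_gaussianReal, hvar] at hchar
  have hnn : 0 ≤ t ⬝ᵥ S *ᵥ t := by
    rw [← hvar]
    exact variance_nonneg _ _
  convert hchar using 2 with n
  · rw [charFun_apply, charFun_apply_real, integral_map (hmeas n) (by fun_prop),
      integral_map (hclt.forall_aemeasurable n) (by fun_prop)]
    congr with ω
    rw [hm, inner_smul_left, sum_inner]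
    simp
  · rw [Real.coe_toNNReal _ hnn]
    simp

end Distribution

/-! ### Moments, limit theorems and measurability for empirical frequencies. -/

open Classical in
/-- The indicator vector of the support points, centered at `r`. -/
def centeredIndicator {N d : ℕ} (x : Fin N → EuclideanSpace ℝ (Fin d)) (r : Fin N → ℝ)
    (z : EuclideanSpace ℝ (Fin d)) : EuclideanSpace ℝ (Fin N) :=
  WithLp.toLp 2 fun i => (if z = x i then 1 else 0) - r i

theorem measurable_centeredIndicator {N d : ℕ} (x : Fin N → EuclideanSpace ℝ (Fin d))
    (r : Fin N → ℝ) : Measurable (centeredIndicator x r) := by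
  classical
  refine (WithLp.measurable_toLp 2 _).comp (measurable_pi_lambda _ fun i => ?_)
  exact (Measurable.ite (measurableSet_singleton (x i)) measurable_const measurable_const).sub_const _

theorem centeredIndicator_apply_self {N d : ℕ} {x : Fin N → EuclideanSpace ℝ (Fin d)}
    (hx : Function.Injective x) (r : Fin N → ℝ) (j i : Fin N) :
    centeredIndicator x r (x j) i = (if j = i then 1 else 0) - r i := by
  simp [centeredIndicator, hx.eq_iff]

theorem inner_centeredIndicator_self {N d : ℕ} {x : Fin N → EuclideanSpace ℝ (Fin d)}
    (hx : Function.Injective x) (r : Fin N → ℝ) (j : Fin N) (t : EuclideanSpace ℝ (Fin N)) :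
    inner ℝ (centeredIndicator x r (x j)) t = t j - ∑ i, r i * t i := by
  simp [PiLp.inner_apply, centeredIndicator_apply_self hx, sub_mul, Finset.sum_sub_distrib,
    mul_comm (t.ofLp _)]

theorem sum_centeredIndicator {N d : ℕ} {Ω : Type*} (x : Fin N → EuclideanSpace ℝ (Fin d))
    (r : Fin N → ℝ) (X : ℕ → Ω → EuclideanSpace ℝ (Fin d)) (n : ℕ) (ω : Ω) (i : Fin N) :
    (∑ l ∈ Finset.range n, centeredIndicator x r (X l ω)) i =
      n * (empirical x X n ω i - r i) := by
  classical
  rcases n.eq_zero_or_pos with rfl | hn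
  · simp
  · have hn' : (n : ℝ) ≠ 0 := by positivity
    have h : (∑ l ∈ Finset.range n, centeredIndicator x r (X l ω)) i =
        ∑ l ∈ Finset.range n, ((if X l ω = x i then 1 else 0) - r i) := by
      rw [WithLp.ofLp_sum, Finset.sum_apply]
      refine Finset.sum_congr rfl fun l _ => ?_
      simp [centeredIndicator]
    rw [h, Finset.sum_sub_distrib, Finset.sum_boole, empirical, mul_sub, mul_div_cancel₀ _ hn']
    simp

theorem inv_sqrt_smul_sum_centeredIndicator {N d : ℕ} {Ω : Type*}
    (x : Fin N → EuclideanSpace ℝ (Fin d)) (r : Fin N → ℝ)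
    (X : ℕ → Ω → EuclideanSpace ℝ (Fin d)) (n : ℕ) (ω : Ω) (i : Fin N) :
    ((√(n : ℝ))⁻¹ • ∑ l ∈ Finset.range n, centeredIndicator x r (X l ω)) i =
      √(n : ℝ) * (empirical x X n ω i - r i) := by
  rw [PiLp.smul_apply, sum_centeredIndicator, smul_eq_mul, ← mul_assoc]
  congr 1
  rcases n.eq_zero_or_pos with rfl | hn
  · simp
  · have h : (0 : ℝ) < √(n : ℝ) := Real.sqrt_pos.2 (by exact_mod_cast hn)
    field_simp
    exact (Real.sq_sqrt (Nat.cast_nonneg n)).symm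

theorem ae_discreteLaw_mem_range {N d : ℕ} {x : Fin N → EuclideanSpace ℝ (Fin d)} {r : Fin N → ℝ} :
    ∀ᵐ z ∂discreteLaw x r, z ∈ Set.range x := by
  rw [discreteLaw, ae_finsetSum_measure_iff]
  intro i _
  refine Measure.ae_smul_measure ?_ _
  refine (ae_dirac_iff (p := fun z => z ∈ Set.range x) (Set.finite_range x).measurableSet).2 ?_
  exact Set.mem_range_self i

theorem integral_discreteLaw {N d : ℕ} {x : Fin N → EuclideanSpace ℝ (Fin d)} {r : Fin N → ℝ}
    (hr : ∀ i, 0 ≤ r i) {f : EuclideanSpace ℝ (Fin d) → ℝ} :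
    ∫ z, f z ∂discreteLaw x r = ∑ i, r i * f (x i) := by
  rw [discreteLaw, integral_finsetSum_measure fun i _ =>
    ((integrable_dirac (by simp)).smul_measure ENNReal.ofReal_ne_top)]
  refine Finset.sum_congr rfl fun i _ => ?_
  rw [integral_smul_measure, integral_dirac, ENNReal.toReal_ofReal (hr i), smul_eq_mul]

theorem dotProduct_covMat_mulVec {N : ℕ} (r : Fin N → ℝ) (t : Fin N → ℝ) :
    t ⬝ᵥ covMat r *ᵥ t = ∑ i, r i * t i ^ 2 - (∑ i, r i * t i) ^ 2 := by
  have hE : covMat r = Matrix.diagonal r - Matrix.vecMulVec r r := by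
    ext i j
    by_cases h : i = j
    · subst h
      simp [covMat, Matrix.vecMulVec_apply]
      ring
    · simp [covMat, Matrix.vecMulVec_apply, h]
  rw [hE, Matrix.sub_mulVec, dotProduct_sub]
  congr 1
  · simp only [dotProduct, Matrix.mulVec_diagonal]
    exact Finset.sum_congr rfl fun i _ => by ring
  · rw [Matrix.vecMulVec_mulVec]
    simp only [dotProduct, Pi.smul_apply, MulOpposite.smul_eq_mul_unop,
      MulOpposite.unop_op, sq, Finset.sum_mul]
    exact Finset.sum_congr rfl fun i _ => by ring

section Sampling

variable {Ω Ω' : Type*} [MeasurableSpace Ω] [MeasurableSpace Ω'] {P : Measure Ω}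
  {Q : Measure Ω'} [IsProbabilityMeasure Q]
  {N d : ℕ} {x : Fin N → EuclideanSpace ℝ (Fin d)} {r : Fin N → ℝ}
  {X : ℕ → Ω → EuclideanSpace ℝ (Fin d)}

theorem memLp_centeredIndicator [IsProbabilityMeasure P] (hX : ∀ i, HasLaw (X i) (discreteLaw x r) P) (l : ℕ)
    (p : ENNReal) : MemLp (fun ω => centeredIndicator x r (X l ω)) p P := by
  have hm : AEMeasurable (fun ω => centeredIndicator x r (X l ω)) P :=
    (measurable_centeredIndicator x r).comp_aemeasurable (hX l).aemeasurable
  refine MemLp.of_bound hm.aestronglyMeasurable (∑ i, ‖centeredIndicator x r (x i)‖) ?_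
  have h := ((hX l).ae_iff (p := fun z => z ∈ Set.range x)
    (Set.finite_range x).measurableSet.mem).2 ae_discreteLaw_mem_range
  filter_upwards [h] with ω ⟨i, hi⟩
  rw [← hi]
  exact Finset.single_le_sum (f := fun i => ‖centeredIndicator x r (x i)‖)
    (fun i _ => norm_nonneg _) (Finset.mem_univ i)

theorem identDistrib_centeredIndicator (hX : ∀ i, HasLaw (X i) (discreteLaw x r) P) (l : ℕ) :
    IdentDistrib (fun ω => centeredIndicator x r (X l ω))
      (fun ω => centeredIndicator x r (X 0 ω)) P P :=
  IdentDistrib.comp (u := centeredIndicator x r)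
    ⟨(hX l).aemeasurable, (hX 0).aemeasurable, (hX l).map_eq.trans (hX 0).map_eq.symm⟩
    (measurable_centeredIndicator x r)

theorem integral_comp_sample (hr : ∀ i, 0 ≤ r i) (hX : ∀ i, HasLaw (X i) (discreteLaw x r) P)
    (l : ℕ) {f : EuclideanSpace ℝ (Fin d) → ℝ} (hf : Measurable f) :
    ∫ ω, f (X l ω) ∂P = ∑ i, r i * f (x i) := by
  rw [← integral_discreteLaw hr]
  exact (hX l).integral_comp hf.aestronglyMeasurable

theorem integral_inner_centeredIndicator (hx : Function.Injective x)
    (hr : r ∈ stdSimplex ℝ (Fin N)) (hX : ∀ i, HasLaw (X i) (discreteLaw x r) P)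
    (t : EuclideanSpace ℝ (Fin N)) :
    ∫ ω, inner ℝ (centeredIndicator x r (X 0 ω)) t ∂P = 0 := by
  have hm := measurable_centeredIndicator x r
  rw [integral_comp_sample hr.1 hX 0 (f := fun z => inner ℝ (centeredIndicator x r z) t)
    (by fun_prop)]
  simp only [inner_centeredIndicator_self hx, mul_sub, Finset.sum_sub_distrib, ← Finset.sum_mul,
    hr.2, one_mul, sub_self]

theorem integral_inner_centeredIndicator_sq (hx : Function.Injective x)
    (hr : r ∈ stdSimplex ℝ (Fin N)) (hX : ∀ i, HasLaw (X i) (discreteLaw x r) P)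
    (t : EuclideanSpace ℝ (Fin N)) :
    ∫ ω, inner ℝ (centeredIndicator x r (X 0 ω)) t ^ 2 ∂P = t ⬝ᵥ covMat r *ᵥ t := by
  have hm := measurable_centeredIndicator x r
  rw [integral_comp_sample hr.1 hX 0 (f := fun z => inner ℝ (centeredIndicator x r z) t ^ 2)
    (by fun_prop), dotProduct_covMat_mulVec]
  simp only [inner_centeredIndicator_self hx]
  set m := ∑ i, r i * t i with hm
  have h1 : ∀ i, r i * (t i - m) ^ 2 = r i * t i ^ 2 - 2 * m * (r i * t i) + m ^ 2 * r i :=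
    fun i => by ring
  simp only [h1, Finset.sum_add_distrib, Finset.sum_sub_distrib, ← Finset.mul_sum, hr.2, ← hm]
  ring

/-- Central limit theorem for the empirical frequencies. -/
theorem tendstoInDistribution_centeredIndicator [IsProbabilityMeasure P] (hx : Function.Injective x)
    (hr : r ∈ stdSimplex ℝ (Fin N)) (hX : ∀ i, HasLaw (X i) (discreteLaw x r) P)
    (hindep : iIndepFun X P) {G : Ω' → EuclideanSpace ℝ (Fin N)}
    (hG : HasLaw G (multivariateGaussian 0 (covMat r)) Q) :
    TendstoInDistribution (fun (n : ℕ) ω =>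
      (√(n : ℝ))⁻¹ • ∑ l ∈ Finset.range n, centeredIndicator x r (X l ω)) atTop G
      (fun _ => P) Q :=
  tendstoInDistribution_inv_sqrt_smul_sum (posSemidef_covMat hr) hG
    (memLp_centeredIndicator hX 0 2)
    (hindep.comp (fun _ => centeredIndicator x r) fun _ => measurable_centeredIndicator x r)
    (identDistrib_centeredIndicator hX) (integral_inner_centeredIndicator hx hr hX)
    (integral_inner_centeredIndicator_sq hx hr hX)

/-- Law of large numbers for the empirical frequencies. -/
theorem ae_tendsto_empirical [IsProbabilityMeasure P] (hx : Function.Injective x)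
    (hr : r ∈ stdSimplex ℝ (Fin N)) (hX : ∀ i, HasLaw (X i) (discreteLaw x r) P)
    (hindep : iIndepFun X P) :
    ∀ᵐ ω ∂P, Tendsto (fun n => empirical x X n ω) atTop (𝓝 r) := by
  have hint : Integrable (fun ω => centeredIndicator x r (X 0 ω)) P :=
    memLp_one_iff_integrable.1 (memLp_centeredIndicator hX 0 1)
  have hmean : ∫ ω, centeredIndicator x r (X 0 ω) ∂P = 0 := by
    refine ext_inner_right ℝ fun t => ?_
    rw [inner_zero_left, real_inner_comm, ← integral_inner hint]
    simp only [real_inner_comm _ t]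
    exact integral_inner_centeredIndicator hx hr hX t
  have hi := hindep.comp (fun _ => centeredIndicator x r) fun _ => measurable_centeredIndicator x r
  have hlln := strong_law_ae (fun l ω => centeredIndicator x r (X l ω)) hint
    (fun i j hij => hi.indepFun hij) (identDistrib_centeredIndicator hX)
  rw [hmean] at hlln
  filter_upwards [hlln] with ω hω
  rw [tendsto_pi_nhds]
  intro i
  have hc : Continuous fun v : EuclideanSpace ℝ (Fin N) => v i := by fun_prop
  have h := ((hc.tendsto 0).comp hω).add_const (r i)
  simp only [PiLp.zero_apply, zero_add] at h
  refine h.congr' ?_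
  filter_upwards [eventually_gt_atTop 0] with n hn
  have hn' : (n : ℝ) ≠ 0 := by positivity
  simp only [Function.comp_apply, PiLp.smul_apply, sum_centeredIndicator, smul_eq_mul]
  field_simp
  ring

theorem ae_empirical_mem_stdSimplex (hx : Function.Injective x)
    (hX : ∀ i, HasLaw (X i) (discreteLaw x r) P) :
    ∀ᵐ ω ∂P, ∀ n, 0 < n → empirical x X n ω ∈ stdSimplex ℝ (Fin N) := by
  classical
  have h : ∀ᵐ ω ∂P, ∀ l, X l ω ∈ Set.range x := ae_all_iff.2 fun l =>
    ((hX l).ae_iff (p := fun z => z ∈ Set.range x)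
      (Set.finite_range x).measurableSet.mem).2 ae_discreteLaw_mem_range
  filter_upwards [h] with ω hω n hn
  refine ⟨fun i => by unfold empirical; positivity, ?_⟩
  have hn' : (n : ℝ) ≠ 0 := by positivity
  choose c hc using hω
  -- Almost surely every sample point has a label `c l`, so the label classes partition the sample.
  have hcard : (Finset.range n).card =
      ∑ i, ((Finset.range n).filter fun l => X l ω = x i).card := by
    rw [Finset.card_eq_sum_card_fiberwise (f := c) (t := Finset.univ) (fun _ _ => by simp)]
    refine Finset.sum_congr rfl fun i _ => congrArg Finset.card (Finset.filter_congr fun l _ => ?_)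
    rw [← hc l, hx.eq_iff]
  simp only [empirical, ← Finset.sum_div]
  rw [div_eq_one_iff_eq hn', ← Nat.cast_sum, ← hcard, Finset.card_range]

/-- Functions of two empirical distributions are measurable, as these take countably many values. -/
theorem aemeasurable_comp_empirical {s : Fin N → ℝ} {Y : ℕ → Ω → EuclideanSpace ℝ (Fin d)}
    (hX : ∀ i, HasLaw (X i) (discreteLaw x r) P) (hY : ∀ i, HasLaw (Y i) (discreteLaw x s) P)
    (n m : ℕ) (F : (Fin N → ℝ) × (Fin N → ℝ) → ℝ) :
    AEMeasurable (fun ω => F (empirical x X n ω, empirical x Y m ω)) P := by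
  classical
  have hcount : ∀ {Z : ℕ → Ω → EuclideanSpace ℝ (Fin d)}, (∀ l, AEMeasurable (Z l) P) → ∀ n,
      AEMeasurable (fun ω i => ((Finset.range n).filter fun l => Z l ω = x i).card) P := by
    intro Z hZ n
    refine aemeasurable_pi_lambda _ fun i => ?_
    simp only [Finset.card_filter]
    refine Finset.aemeasurable_fun_sum _ fun l _ => ?_
    have : Measurable fun z => if z = x i then 1 else 0 :=
      Measurable.ite (measurableSet_singleton (x i)) measurable_const measurable_const
    exact this.comp_aemeasurable (hZ l)
  have hg : Measurable fun q : (Fin N → ℕ) × (Fin N → ℕ) =>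
      F (fun i => (q.1 i : ℝ) / (n : ℝ), fun i => (q.2 i : ℝ) / (m : ℝ)) := Measurable.of_discrete
  have h := hg.comp_aemeasurable ((hcount (fun l => (hX l).aemeasurable) n).prodMk
    (hcount (fun l => (hY l).aemeasurable) m))
  convert h using 1
  ext ω
  simp only [Function.comp_apply]
  congr!

end Sampling

/-- The two sums use disjoint finite blocks of one independent family. -/
theorem indepFun_smul_sum_smul_sum {Ω α E : Type*} [MeasurableSpace Ω] [MeasurableSpace α]
    [NormedAddCommGroup E] [NormedSpace ℝ E] [MeasurableSpace E] [BorelSpace E]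
    [SecondCountableTopology E] {P : Measure Ω} {X Y : ℕ → Ω → α}
    (hX : ∀ i, AEMeasurable (X i) P) (hY : ∀ i, AEMeasurable (Y i) P)
    (hXY : iIndepFun (Sum.elim X Y : ℕ ⊕ ℕ → Ω → α) P) {f g : α → E} (hf : Measurable f)
    (hg : Measurable g) (a b : ℝ) (n m : ℕ) :
    IndepFun (fun ω => a • ∑ l ∈ Finset.range n, f (X l ω))
      (fun ω => b • ∑ l ∈ Finset.range m, g (Y l ω)) P := by
  set S : Finset (ℕ ⊕ ℕ) := (Finset.range n).map Function.Embedding.inl with hS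
  set T : Finset (ℕ ⊕ ℕ) := (Finset.range m).map Function.Embedding.inr with hT
  have hST : Disjoint S T := by
    rw [Finset.disjoint_left]
    intro z hz hz'
    simp only [hS, hT, Finset.mem_map, Function.Embedding.inl_apply,
      Function.Embedding.inr_apply] at hz hz'
    obtain ⟨_, _, rfl⟩ := hz
    obtain ⟨_, _, h⟩ := hz'
    exact Sum.inr_ne_inl h
  have h := hXY.indepFun_finset₀ S T hST fun i => by
    rcases i with i | i
    exacts [hX i, hY i]
  have hφ : ∀ {f : α → E} (_ : Measurable f) (a : ℝ) (S : Finset (ℕ ⊕ ℕ)),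
      Measurable fun v : S → α => a • ∑ i : S, f (v i) := fun hf a S =>
    (Finset.measurable_fun_sum _ fun i _ => hf.comp (measurable_pi_apply i)).const_smul a
  have h2 := h.comp (hφ hf a S) (hφ hg b T)
  convert h2 using 1
  · ext ω
    simp only [Function.comp_apply]
    rw [Finset.sum_coe_sort S fun i => f (Sum.elim X Y i ω)]
    simp [hS]
  · ext ω
    simp only [Function.comp_apply]
    rw [Finset.sum_coe_sort T fun i => g (Sum.elim X Y i ω)]
    simp [hT]

/-! ### The delta method and the limit law. -/

/-- Random delta method: if a statistic of the pair of empirical distributions has a first order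
expansion with a continuous positively homogeneous derivative, tangentially to the simplex, then it
is asymptotically distributed as the derivative at the Gaussian limit. -/
theorem tendstoInDistribution_of_directional_expansion {N d : ℕ}
    {x : Fin (N + 1) → EuclideanSpace ℝ (Fin d)} (hx : Function.Injective x)
    {r s : Fin (N + 1) → ℝ} (hr : r ∈ stdSimplex ℝ (Fin (N + 1)))
    (hs : s ∈ stdSimplex ℝ (Fin (N + 1)))
    {M φ : (Fin (N + 1) → ℝ) × (Fin (N + 1) → ℝ) → ℝ} (hφ : Continuous φ)
    (hφh : ∀ t : ℝ, 0 ≤ t → ∀ h, φ (t • h) = t * φ h)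
    (hM : ∀ ε > 0, ∀ᶠ b in 𝓝[simplexPairs N] (r, s),
      |M b - M (r, s) - φ (b - (r, s))| ≤ ε * ‖b - (r, s)‖)
    {Ω : Type*} [MeasurableSpace Ω] {P : Measure Ω} [IsProbabilityMeasure P]
    {X Y : ℕ → Ω → EuclideanSpace ℝ (Fin d)}
    (hX : ∀ i, HasLaw (X i) (discreteLaw x r) P) (hY : ∀ i, HasLaw (Y i) (discreteLaw x s) P)
    (hXY : iIndepFun (Sum.elim X Y : ℕ ⊕ ℕ → Ω → EuclideanSpace ℝ (Fin d)) P)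
    {n m : ℕ → ℕ} (hn : Tendsto n atTop atTop) (hm : Tendsto m atTop atTop) {δ : ℝ}
    (hnm : Tendsto (fun l => (m l : ℝ) / ((n l : ℝ) + (m l : ℝ))) atTop (𝓝 δ))
    {Ω' : Type*} [MeasurableSpace Ω'] {Q : Measure Ω'} [IsProbabilityMeasure Q]
    {G H : Ω' → EuclideanSpace ℝ (Fin (N + 1))}
    (hG : HasLaw G (multivariateGaussian 0 (covMat r)) Q)
    (hH : HasLaw H (multivariateGaussian 0 (covMat s)) Q) (hGH : IndepFun G H Q) :
    TendstoInDistribution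
      (fun (l : ℕ) ω => √((n l : ℝ) * (m l : ℝ) / ((n l : ℝ) + (m l : ℝ))) *
        (M (empirical x X (n l) ω, empirical x Y (m l) ω) - M (r, s)))
      atTop (fun ω => φ (fun i => √δ * G ω i, fun i => √(1 - δ) * H ω i)) (fun _ => P) Q := by
  have hiX : iIndepFun X P := hXY.precomp (g := Sum.inl) Sum.inl_injective
  have hiY : iIndepFun Y P := hXY.precomp (g := Sum.inr) Sum.inr_injective
  have hU := tendstoInDistribution_centeredIndicator hx hr hX hiX hG
  have hV := tendstoInDistribution_centeredIndicator hx hs hY hiY hH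
  have hpair := tendstoInDistribution_prodMk_of_indepFun
    (U := fun (l : ℕ) ω =>
      (√(n l : ℝ))⁻¹ • ∑ i ∈ Finset.range (n l), centeredIndicator x r (X i ω))
    (V := fun (l : ℕ) ω =>
      (√(m l : ℝ))⁻¹ • ∑ i ∈ Finset.range (m l), centeredIndicator x s (Y i ω))
    ⟨fun l => hU.forall_aemeasurable (n l), hU.aemeasurable_limit, hU.tendsto.comp hn⟩
    ⟨fun l => hV.forall_aemeasurable (m l), hV.aemeasurable_limit, hV.tendsto.comp hm⟩
    (fun l => indepFun_smul_sum_smul_sum (fun i => (hX i).aemeasurable)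
      (fun i => (hY i).aemeasurable) hXY (measurable_centeredIndicator x r)
      (measurable_centeredIndicator x s) _ _ _ _) hGH
  -- The relative remainder of the expansion; at `b = (r, s)` the division by zero gives `0`,
  -- consistent with the vanishing of the remainder there.
  set ρ : (Fin (N + 1) → ℝ) × (Fin (N + 1) → ℝ) → ℝ := fun b =>
    (M b - M (r, s) - φ (b - (r, s))) / ‖b - (r, s)‖ with hρ
  have hρlim : Tendsto ρ (𝓝[simplexPairs N] (r, s)) (𝓝 0) := by
    rw [Metric.tendsto_nhds]
    intro ε hε
    filter_upwards [hM (ε / 2) (half_pos hε)] with b hb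
    rw [dist_zero_right, hρ, norm_div, norm_norm, Real.norm_eq_abs]
    exact (div_le_of_le_mul₀ (norm_nonneg _) (half_pos hε).le hb).trans_lt (half_lt_self hε)
  have hρae : ∀ᵐ ω ∂P, Tendsto (fun l => ρ (empirical x X (n l) ω, empirical x Y (m l) ω)) atTop
      (𝓝 0) := by
    filter_upwards [ae_tendsto_empirical hx hr hX hiX, ae_tendsto_empirical hx hs hY hiY,
      ae_empirical_mem_stdSimplex hx hX, ae_empirical_mem_stdSimplex hx hY] with ω h1 h2 h3 h4
    refine hρlim.comp (tendsto_nhdsWithin_iff.2 ⟨(h1.comp hn).prodMk_nhds (h2.comp hm), ?_⟩)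
    filter_upwards [hn.eventually (eventually_gt_atTop 0), hm.eventually (eventually_gt_atTop 0)]
      with l hl hl'
    exact ⟨h3 _ hl, h4 _ hl'⟩
  have hnm' : Tendsto (fun l => (n l : ℝ) / ((n l : ℝ) + (m l : ℝ))) atTop (𝓝 (1 - δ)) := by
    refine (hnm.const_sub 1).congr' ?_
    filter_upwards [hn.eventually (eventually_gt_atTop 0)] with l hl
    have : (0 : ℝ) < n l := by exact_mod_cast hl
    have : (n l : ℝ) + m l ≠ 0 := by positivity
    field_simp
    ring
  -- The sample-size weights and the remainder all converge to constants, so Slutsky's theorem joins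
  -- them to the Gaussian limit without any independence.
  set R : ℕ → Ω → ℝ × ℝ × ℝ := fun l ω =>
    (√((m l : ℝ) / ((n l : ℝ) + (m l : ℝ))), √((n l : ℝ) / ((n l : ℝ) + (m l : ℝ))),
      ρ (empirical x X (n l) ω, empirical x Y (m l) ω)) with hR
  have hRmeas : ∀ l, AEMeasurable (R l) P := fun l =>
    aemeasurable_const.prodMk (aemeasurable_const.prodMk
      (aemeasurable_comp_empirical hX hY (n l) (m l) ρ))
  have hRlim : TendstoInMeasure P R atTop fun _ => (√δ, √(1 - δ), (0 : ℝ)) := by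
    refine tendstoInMeasure_of_tendsto_ae (fun l => (hRmeas l).aestronglyMeasurable) ?_
    filter_upwards [hρae] with ω hω
    exact hnm.sqrt.prodMk_nhds (hnm'.sqrt.prodMk_nhds hω)
  let scale : (EuclideanSpace ℝ (Fin (N + 1)) × EuclideanSpace ℝ (Fin (N + 1))) × (ℝ × ℝ × ℝ) →
      (Fin (N + 1) → ℝ) × (Fin (N + 1) → ℝ) := fun q =>
    (fun i => q.2.1 * q.1.1 i, fun i => q.2.2.1 * q.1.2 i)
  have hscale : Continuous scale := by
    refine Continuous.prodMk (continuous_pi fun i => ?_) (continuous_pi fun i => ?_) <;> fun_prop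
  have hg : Continuous fun q => φ (scale q) + ‖scale q‖ * q.2.2.2 :=
    (hφ.comp hscale).add (hscale.norm.mul (by fun_prop))
  have hlim := hpair.continuous_comp_prodMk_of_tendstoInMeasure_const hg hRlim hRmeas
  refine hlim.congr (fun l => Eventually.of_forall fun ω => ?_)
    (Eventually.of_forall fun ω => by simp [scale])
  set b : (Fin (N + 1) → ℝ) × (Fin (N + 1) → ℝ) :=
    (empirical x X (n l) ω, empirical x Y (m l) ω) with hb
  set c : ℝ := √((n l : ℝ) * (m l : ℝ) / ((n l : ℝ) + (m l : ℝ))) with hc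
  have hc0 : 0 ≤ c := Real.sqrt_nonneg _
  -- The factor `√n` of the central limit theorem and the weight `√(m / (n + m))` combine to the
  -- common normalization `c`; this is why `√δ` multiplies `G`.
  have hc1 : √((m l : ℝ) / ((n l : ℝ) + (m l : ℝ))) * √(n l : ℝ) = c := by
    rw [hc, ← Real.sqrt_mul (by positivity)]
    congr 1
    ring
  have hc2 : √((n l : ℝ) / ((n l : ℝ) + (m l : ℝ))) * √(m l : ℝ) = c := by
    rw [hc, ← Real.sqrt_mul (by positivity)]
    congr 1
    ring
  have hsc : scale (((√(n l : ℝ))⁻¹ • ∑ i ∈ Finset.range (n l), centeredIndicator x r (X i ω),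
      (√(m l : ℝ))⁻¹ • ∑ i ∈ Finset.range (m l), centeredIndicator x s (Y i ω)), R l ω) =
      c • (b - (r, s)) := by
    refine Prod.ext (funext fun i => ?_) (funext fun i => ?_)
    · simp only [scale, inv_sqrt_smul_sum_centeredIndicator, hR, ← mul_assoc, hc1]
      rfl
    · simp only [scale, inv_sqrt_smul_sum_centeredIndicator, hR, ← mul_assoc, hc2]
      rfl
  simp only [hsc]
  -- Positive homogeneity pulls `c` out of `φ`, after which derivative and remainder add up exactly
  -- to the increment of `M`.
  rw [hφh c hc0, norm_smul, Real.norm_of_nonneg hc0]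
  have hρb : ‖b - (r, s)‖ * ρ b = M b - M (r, s) - φ (b - (r, s)) := by
    rcases eq_or_ne b (r, s) with h | h
    · have h0 := hφh 0 le_rfl 0
      rw [zero_smul, zero_mul] at h0
      rw [h, sub_self, sub_self, h0, norm_zero, zero_mul, sub_zero]
    · have : ‖b - (r, s)‖ ≠ 0 := norm_ne_zero_iff.2 (sub_ne_zero.2 h)
      rw [hρ]
      field_simp
  change c * φ (b - (r, s)) + c * ‖b - (r, s)‖ * ρ b = c * (M b - M (r, s))
  rw [mul_assoc, hρb]
  ring

end PRW

end

theorem theorem4 {N d k p : ℕ} (hk : 1 ≤ k) (hkd : k ≤ d) (hp : Even p) (hp1 : 1 ≤ p)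
    {lam : ℝ} (hlam : 0 < lam)
    -- the `N + 1 ≥ 1` distinct support points and two strictly positive probability vectors
    (x : Fin (N + 1) → EuclideanSpace ℝ (Fin d)) (hx : Function.Injective x)
    (r s : Fin (N + 1) → ℝ) (hr : r ∈ PRW.posSimplex (N + 1)) (hs : s ∈ PRW.posSimplex (N + 1))
    -- two independent i.i.d. samples, from `r` and from `s`
    {Ω : Type*} [MeasurableSpace Ω] (P : Measure Ω) [IsProbabilityMeasure P]
    (X Y : ℕ → Ω → EuclideanSpace ℝ (Fin d))
    (hX : ∀ i, HasLaw (X i) (PRW.discreteLaw x r) P)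
    (hY : ∀ i, HasLaw (Y i) (PRW.discreteLaw x s) P)
    (hXY : iIndepFun (Sum.elim X Y : ℕ ⊕ ℕ → Ω → EuclideanSpace ℝ (Fin d)) P)
    -- the sample sizes
    (n m : ℕ → ℕ) (hn : Tendsto n atTop atTop) (hm : Tendsto m atTop atTop)
    (δ : ℝ) (hδ : δ ∈ Set.Ioo (0 : ℝ) 1)
    (hnm : Tendsto (fun l => (m l : ℝ) / ((n l : ℝ) + (m l : ℝ))) atTop (𝓝 δ))
    -- the independent Gaussian vectors
    {Ω' : Type*} [MeasurableSpace Ω'] (Q : Measure Ω') [IsProbabilityMeasure Q]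
    (G H : Ω' → EuclideanSpace ℝ (Fin (N + 1)))
    (hG : HasLaw G (multivariateGaussian 0 (PRW.covMat r)) Q)
    (hH : HasLaw H (multivariateGaussian 0 (PRW.covMat s)) Q)
    (hGH : IndepFun G H Q) :
    ∃ Z : Ω' → ℝ,
      (∀ ω, IsGreatest
        ((fun E => PRW.dirDeriv p lam x r s
          (fun i => √δ * G ω i) (fun i => √(1 - δ) * H ω i) E) '' PRW.optDirs k p lam x r s)
        (Z ω)) ∧
      TendstoInDistribution
        (fun (l : ℕ) ω => √((n l : ℝ) * (m l : ℝ) / ((n l : ℝ) + (m l : ℝ))) *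
          (PRW.regPW k p lam x (PRW.empirical x X (n l) ω) (PRW.empirical x Y (m l) ω) -
            PRW.regPW k p lam x r s))
        atTop Z (fun _ => P) Q := by
  obtain ⟨φ, hφ, hφh, hφg, hφe⟩ :=
    PRW.exists_directional_expansion_regPW (k := k) (p := p) hk hkd hp1 hlam hx hr hs
  -- The limit variable is `φ` at the scaled Gaussian pair, and the maximum is attained for every
  -- `ω`, not only almost surely.
  exact ⟨_, fun ω => hφg (fun i => √δ * G ω i, fun i => √(1 - δ) * H ω i),
    PRW.tendstoInDistribution_of_directional_expansion (M := fun b => PRW.regPW k p lam x b.1 b.2)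
      hx (PRW.posSimplex_subset_stdSimplex hr) (PRW.posSimplex_subset_stdSimplex hs) hφ hφh hφe
      hX hY hXY hn hm hnm hG hH hGH⟩
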